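/- Let $m<n$ be positive integers and let $D\subseteq\{0,\dots,m-1\}\times\{0,\dots,n-1\}$ be a digit set that contains two elements $(i,j),(i',j')$ with $i\neq i'$ and two elements with $j\neq j'$ (so $D$ meets at least two rows and at least two columns). For $(i,j)\in D$ let $T_{i,j}:\mathbb{R}^2\to\mathbb{R}^2$, $T_{i,j}(x,y)=(n^{-1}x,m^{-1}y)+(j,i)$, and let $\Lambda$ be the unique non-empty compact set with $\Lambda=\bigcup_{(i,j)\in D}T_{i,j}(\Lambda)$. Let $(p_{ij})_{(i,j)\in D}$ be a probability vector with all $p_{ij}>0$, and let $\mu$ be the unique Borel probability measure on $\mathbb{R}^2$ with $\mu(A)=\sum_{(i,j)\in D}p_{ij}\,\mu(T_{i,j}^{-1}A)$ for every Borel set $A$. No separation condition is assumed. Put $\sigma=\frac{\log m}{\log n}$, $q_i=\sum_{j:(i,j)\in D}p_{ij}$ and, for $t\in\mathbb{R}$, $\gamma_i(t)=\sum_{j:(i,j)\in D}p_{ij}^t$, and let $\beta(t)$ be the unique real solution of $$m^{-\beta(t)}\sum_{(i,j)\in D}p_{ij}^t\,q_i^{(1-\sigma)t}\,\gamma_i(t)^{\sigma-1}=1.$$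 Let $\alpha_{\min}$ and $\alpha_{\max}$ be the minimum and the maximum over $(i,j)\in D$ of $\frac{-\sigma\log p_{ij}+(\sigma-1)\log q_i}{\log m}$. For $\alpha\in\mathbb{R}$ let $X_\alpha$ be the set of those $x\in\Lambda$ for which the local dimension $d_\mu(x)=\lim_{r\to0}\frac{\log\mu(B(x,r))}{\log r}$ exists and equals $\alpha$, and let $f(\alpha)=\dim X_\alpha$ be its Hausdorff dimension. Then for every $\alpha\in(\alpha_{\min},\alpha_{\max})$ $$f(\alpha)=\dim X_\alpha=\inf_{t\in\mathbb{R}}\bigl(\alpha t+\beta(t)\bigr),$$ and $f$ is differentiable and concave on $(\alpha_{\min},\alpha_{\max})$. -/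

import Mathlib

open MeasureTheory Set Filter Topology

namespace BedfordMcMullen

/-- The affine contraction `(x, y) ↦ (x / n, y / m) + (j, i)` of the plane attached to the digit
`d = (i, j)`, with row index `i < m` and column index `j < n`. -/
noncomputable def T {m n : ℕ} (d : Fin m × Fin n) (x : EuclideanSpace ℝ (Fin 2)) :
    EuclideanSpace ℝ (Fin 2) :=
  !₂[x 0 / n + (d.2 : ℕ), x 1 / m + (d.1 : ℕ)]

/-- `Λ` is the non-empty compact set invariant under the maps `T d`, `d ∈ D`. -/
structure IsCarpet {m n : ℕ} (D : Finset (Fin m × Fin n))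
    (Λ : Set (EuclideanSpace ℝ (Fin 2))) : Prop where
  nonempty : Λ.Nonempty
  isCompact : IsCompact Λ
  iUnion_eq : ⋃ d ∈ D, T d '' Λ = Λ

/-- `μ` is the self-affine probability measure of the maps `T d`, `d ∈ D`, with weights `p d`. -/
structure IsSelfAffineMeasure {m n : ℕ} (D : Finset (Fin m × Fin n)) (p : Fin m × Fin n → ℝ)
    (μ : Measure (EuclideanSpace ℝ (Fin 2))) : Prop where
  isProbabilityMeasure : IsProbabilityMeasure μ
  measure_eq : ∀ A, MeasurableSet A → μ A = ∑ d ∈ D, ENNReal.ofReal (p d) * μ (T d ⁻¹' A)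

/-- The local dimension of `μ` at `x` exists and equals `α`. -/
def HasLocalDim (μ : Measure (EuclideanSpace ℝ (Fin 2))) (x : EuclideanSpace ℝ (Fin 2))
    (α : ℝ) : Prop :=
  Tendsto (fun r : ℝ => Real.log (μ.real (Metric.closedBall x r)) / Real.log r) (𝓝[>] 0) (𝓝 α)

/-- The points of `Λ` at which the local dimension of `μ` exists and equals `α`. -/
def levelSet (Λ : Set (EuclideanSpace ℝ (Fin 2))) (μ : Measure (EuclideanSpace ℝ (Fin 2)))
    (α : ℝ) : Set (EuclideanSpace ℝ (Fin 2)) :=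
  {x | x ∈ Λ ∧ HasLocalDim μ x α}

/-- `σ = log m / log n`. -/
noncomputable def sigma (m n : ℕ) : ℝ := Real.log m / Real.log n

/-- `γ_i(t) = ∑_{j : (i, j) ∈ D} p_{ij} ^ t`. -/
noncomputable def gamma {m n : ℕ} (D : Finset (Fin m × Fin n)) (p : Fin m × Fin n → ℝ)
    (t : ℝ) (i : Fin m) : ℝ :=
  ∑ d ∈ D with d.1 = i, p d ^ t

/-- The row weight `q_i = ∑_{j : (i, j) ∈ D} p_{ij}`. -/
noncomputable def q {m n : ℕ} (D : Finset (Fin m × Fin n)) (p : Fin m × Fin n → ℝ)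
    (i : Fin m) : ℝ :=
  ∑ d ∈ D with d.1 = i, p d

/-- `∑_{(i, j) ∈ D} p_{ij} ^ t q_i ^ ((1 - σ) t) γ_i(t) ^ (σ - 1)`. -/
noncomputable def pressureSum {m n : ℕ} (D : Finset (Fin m × Fin n)) (p : Fin m × Fin n → ℝ)
    (t : ℝ) : ℝ :=
  ∑ d ∈ D, p d ^ t * q D p d.1 ^ ((1 - sigma m n) * t) * gamma D p t d.1 ^ (sigma m n - 1)

/-- The function `β`; it is the solution of `m ^ (-β) * pressureSum = 1`, see `eq_beta_iff`. -/
noncomputable def beta {m n : ℕ} (D : Finset (Fin m × Fin n)) (p : Fin m × Fin n → ℝ)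
    (t : ℝ) : ℝ :=
  Real.logb m (pressureSum D p t)

/-- `(-σ log p_{ij} + (σ - 1) log q_i) / log m`. -/
noncomputable def digitExponent {m n : ℕ} (D : Finset (Fin m × Fin n)) (p : Fin m × Fin n → ℝ)
    (d : Fin m × Fin n) : ℝ :=
  (-sigma m n * Real.log (p d) + (sigma m n - 1) * Real.log (q D p d.1)) / Real.log m

/-- The minimum of `digitExponent` over `D`. -/
noncomputable def alphaMin {m n : ℕ} (D : Finset (Fin m × Fin n)) (p : Fin m × Fin n → ℝ) : ℝ :=
  ⨅ d : D, digitExponent D p d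

/-- The maximum of `digitExponent` over `D`. -/
noncomputable def alphaMax {m n : ℕ} (D : Finset (Fin m × Fin n)) (p : Fin m × Fin n → ℝ) : ℝ :=
  ⨆ d : D, digitExponent D p d

/-! ### `beta` is the solution of its defining equation -/

theorem pressureSum_pos {m n : ℕ} {D : Finset (Fin m × Fin n)} {p : Fin m × Fin n → ℝ}
    (hD : D.Nonempty) (hp : ∀ d ∈ D, 0 < p d) (t : ℝ) : 0 < pressureSum D p t := by
  refine Finset.sum_pos (fun d hd => ?_) hD
  have hq : 0 < q D p d.1 :=
    Finset.sum_pos (fun e he => hp e (Finset.mem_filter.1 he).1) ⟨d, by simp [hd]⟩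
  have hg : 0 < gamma D p t d.1 :=
    Finset.sum_pos (fun e he => Real.rpow_pos_of_pos (hp e (Finset.mem_filter.1 he).1) _)
      ⟨d, by simp [hd]⟩
  have := hp d hd
  positivity

theorem eq_beta_iff {m n : ℕ} (hm : 1 < m) {D : Finset (Fin m × Fin n)}
    {p : Fin m × Fin n → ℝ} (hD : D.Nonempty) (hp : ∀ d ∈ D, 0 < p d) (t b : ℝ) :
    b = beta D p t ↔ (m : ℝ) ^ (-b) * pressureSum D p t = 1 := by
  have hm' : (1 : ℝ) < m := by exact_mod_cast hm
  have hS := pressureSum_pos hD hp t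
  have h0 : (0 : ℝ) < m := by linarith
  rw [Real.rpow_neg h0.le, inv_mul_eq_one₀ (by positivity), beta, eq_comm,
    Real.logb_eq_iff_rpow_eq h0 hm'.ne' hS]

/-! ### The carpet and the self-affine measure exist -/

/-- The point of the plane coded by a sequence of digits. -/
noncomputable def code {m n : ℕ} (D : Finset (Fin m × Fin n)) (w : ℕ → D) :
    EuclideanSpace ℝ (Fin 2) :=
  !₂[∑' k, ((w k).1.2 : ℕ) * ((n : ℝ)⁻¹) ^ k, ∑' k, ((w k).1.1 : ℕ) * ((m : ℝ)⁻¹) ^ k]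

/-- The sequence `w` with the digit `d` put in front. -/
def cons {α : Type*} (d : α) (w : ℕ → α) : ℕ → α
  | 0 => d
  | k + 1 => w k

theorem summable_digits {b : ℕ} (hb : 1 < b) (a : ℕ → Fin b) :
    Summable fun k => ((a k : ℕ) : ℝ) * ((b : ℝ)⁻¹) ^ k := by
  have hb' : (1 : ℝ) < b := by exact_mod_cast hb
  refine Summable.of_nonneg_of_le (fun k => by positivity) (fun k => ?_)
    ((summable_geometric_of_lt_one (by positivity) (inv_lt_one_of_one_lt₀ hb')).mul_left (b : ℝ))
  gcongr
  exact (a k).2.le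

theorem continuous_digits {b : ℕ} (hb : 1 < b) {α : Type*} [TopologicalSpace α]
    [DiscreteTopology α] (g : α → Fin b) :
    Continuous fun w : ℕ → α => ∑' k, ((g (w k) : ℕ) : ℝ) * ((b : ℝ)⁻¹) ^ k := by
  have hb' : (1 : ℝ) < b := by exact_mod_cast hb
  refine continuous_tsum (u := fun k => (b : ℝ) * ((b : ℝ)⁻¹) ^ k) (fun k => ?_)
    ((summable_geometric_of_lt_one (by positivity) (inv_lt_one_of_one_lt₀ hb')).mul_left (b : ℝ))
    (fun k w => ?_)
  · exact ((continuous_of_discreteTopology (f := fun a : α => ((g a : ℕ) : ℝ))).comp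
      (continuous_apply k)).mul continuous_const
  · rw [Real.norm_of_nonneg (by positivity)]
    gcongr
    exact (g (w k)).2.le

theorem continuous_code {m n : ℕ} (hm : 1 < m) (hn : 1 < n) (D : Finset (Fin m × Fin n)) :
    Continuous (code D) := by
  have h1 := continuous_digits hn (fun d : D => d.1.2)
  have h2 := continuous_digits hm (fun d : D => d.1.1)
  refine (PiLp.continuous_toLp 2 _).comp (continuous_pi fun i => ?_)
  fin_cases i
  · exact h1
  · exact h2

theorem code_cons {m n : ℕ} (hm : 1 < m) (hn : 1 < n) (D : Finset (Fin m × Fin n)) (d : D)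
    (w : ℕ → D) : code D (cons d w) = T d.1 (code D w) := by
  have h1 := (summable_digits hn fun k => (cons d w k).1.2).tsum_eq_zero_add
  have h2 := (summable_digits hm fun k => (cons d w k).1.1).tsum_eq_zero_add
  ext i
  fin_cases i
  · simp only [code, T] at h1 ⊢
    simp only [Fin.zero_eta, Matrix.cons_val_zero]
    rw [h1, div_eq_mul_inv, ← tsum_mul_right]
    simp [cons, pow_succ, mul_assoc, add_comm]
  · simp only [code, T] at h2 ⊢
    simp only [Fin.mk_one, Matrix.cons_val_one, Matrix.cons_val_fin_one]
    rw [h2, div_eq_mul_inv, ← tsum_mul_right]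
    simp [cons, pow_succ, mul_assoc, add_comm]

theorem isCarpet_range_code {m n : ℕ} (hm : 1 < m) (hn : 1 < n) {D : Finset (Fin m × Fin n)}
    (hD : D.Nonempty) : IsCarpet D (range (code D)) where
  nonempty := by
    obtain ⟨d, hd⟩ := hD
    exact ⟨_, fun _ => ⟨d, hd⟩, rfl⟩
  isCompact := isCompact_range (continuous_code hm hn D)
  iUnion_eq := by
    ext x
    simp only [mem_iUnion, mem_image, mem_range, exists_exists_eq_and]
    constructor
    · rintro ⟨d, hd, w, rfl⟩
      exact ⟨cons ⟨d, hd⟩ w, code_cons hm hn D ⟨d, hd⟩ w⟩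
    · rintro ⟨w, rfl⟩
      refine ⟨(w 0).1, (w 0).2, fun k => w (k + 1), ?_⟩
      rw [← code_cons hm hn D (w 0)]
      congr 1
      ext1 k
      cases k <;> rfl

/-- The weights `p` as a measure on the digits. -/
noncomputable def digitMeasure {m n : ℕ} (D : Finset (Fin m × Fin n)) (p : Fin m × Fin n → ℝ) :
    Measure D :=
  ∑ d : D, ENNReal.ofReal (p d) • Measure.dirac d

theorem isProbabilityMeasure_digitMeasure {m n : ℕ} {D : Finset (Fin m × Fin n)}
    {p : Fin m × Fin n → ℝ} (hp : ∀ d ∈ D, 0 < p d) (hp1 : ∑ d ∈ D, p d = 1) :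
    IsProbabilityMeasure (digitMeasure D p) := by
  constructor
  simp only [digitMeasure, Measure.coe_finsetSum, Finset.sum_apply, Measure.smul_apply,
    measure_univ, smul_eq_mul, mul_one]
  rw [Finset.sum_coe_sort D (fun d => ENNReal.ofReal (p d)),
    ← ENNReal.ofReal_sum_of_nonneg (fun d hd => (hp d hd).le), hp1, ENNReal.ofReal_one]

theorem measurable_cons {α : Type*} [MeasurableSpace α] (d : α) :
    Measurable (cons d : (ℕ → α) → ℕ → α) := by
  refine measurable_pi_lambda _ fun k => ?_
  cases k
  · exact measurable_const
  · exact measurable_pi_apply _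

theorem sum_map_cons {m n : ℕ} {D : Finset (Fin m × Fin n)} {p : Fin m × Fin n → ℝ}
    [IsProbabilityMeasure (digitMeasure D p)] :
    ∑ d : D, ENNReal.ofReal (p d) •
      (Measure.infinitePi fun _ : ℕ => digitMeasure D p).map (cons d) =
      Measure.infinitePi fun _ : ℕ => digitMeasure D p := by
  classical
  refine Measure.eq_infinitePi _ fun s t ht => ?_
  obtain ⟨N, hN⟩ : ∃ N, s ⊆ Finset.range (N + 1) :=
    ⟨s.sup id, fun k hk => Finset.mem_range.2 (Nat.lt_succ_of_le (Finset.le_sup (f := id) hk))⟩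
  set t' : ℕ → Set D := fun k => if k ∈ s then t k else univ with ht'
  have mt' : ∀ k, MeasurableSet (t' k) := fun k => by
    simp only [ht']
    split_ifs
    exacts [ht k, MeasurableSet.univ]
  have hpi : Set.pi (s : Set ℕ) t = Set.pi (Finset.range (N + 1) : Set ℕ) t' := by
    ext w
    simp only [Set.mem_pi, Finset.mem_coe, ht']
    constructor
    · intro h k _
      split_ifs with hk
      exacts [h k hk, mem_univ _]
    · intro h k hk
      simpa [hk] using h k (hN hk)
  have hprod : ∏ k ∈ s, digitMeasure D p (t k) =
      ∏ k ∈ Finset.range (N + 1), digitMeasure D p (t' k) := by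
    rw [← Finset.prod_subset hN fun k _ hk => by simp [ht', hk]]
    exact Finset.prod_congr rfl fun k hk => by simp [ht', hk]
  have hpre : ∀ d : D, (cons d : (ℕ → D) → ℕ → D) ⁻¹' (Set.pi (Finset.range (N + 1) : Set ℕ) t') =
      if d ∈ t' 0 then Set.pi (Finset.range N : Set ℕ) (fun k => t' (k + 1)) else ∅ := by
    intro d
    have key : ∀ w : ℕ → D, (∀ k < N + 1, cons d w k ∈ t' k) ↔
        d ∈ t' 0 ∧ ∀ k < N, w k ∈ t' (k + 1) := by
      intro w
      refine ⟨fun h => ⟨h 0 (by omega), fun k hk => h (k + 1) (by omega)⟩, fun h k hk => ?_⟩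
      cases k with
      | zero => exact h.1
      | succ k => exact h.2 k (by omega)
    ext w
    simp only [mem_preimage, Set.mem_pi, Finset.mem_coe, Finset.mem_range, key]
    split_ifs with h <;> simp [h]
  have hm0 : MeasurableSet (Set.pi (Finset.range (N + 1) : Set ℕ) t') :=
    MeasurableSet.pi (Finset.countable_toSet _) fun k _ => mt' k
  have hterm : ∀ d : D, ((Measure.infinitePi fun _ : ℕ => digitMeasure D p).map (cons d))
      (Set.pi (Finset.range (N + 1) : Set ℕ) t') =
      (t' 0).indicator 1 d * ∏ k ∈ Finset.range N, digitMeasure D p (t' (k + 1)) := by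
    intro d
    rw [Measure.map_apply (measurable_cons d) hm0, hpre]
    split_ifs with h
    · rw [Measure.infinitePi_pi _ fun k _ => mt' (k + 1)]
      simp [h]
    · simp [h]
  rw [hpi, hprod, Finset.prod_range_succ']
  simp only [Measure.coe_finsetSum, Finset.sum_apply, Measure.smul_apply, smul_eq_mul, hterm]
  rw [mul_comm, digitMeasure]
  simp only [Measure.coe_finsetSum, Finset.sum_apply, Measure.smul_apply, smul_eq_mul,
    Measure.dirac_apply' _ (mt' 0), Finset.sum_mul, mul_assoc]

theorem continuous_T {m n : ℕ} (d : Fin m × Fin n) : Continuous (T d) := by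
  refine (PiLp.continuous_toLp 2 _).comp (continuous_pi fun i => ?_)
  fin_cases i
  · exact ((PiLp.continuous_apply 2 _ 0).div_const _).add_const _
  · exact ((PiLp.continuous_apply 2 _ 1).div_const _).add_const _

theorem exists_isSelfAffineMeasure {m n : ℕ} (hm : 1 < m) (hn : 1 < n)
    {D : Finset (Fin m × Fin n)} {p : Fin m × Fin n → ℝ} (hp : ∀ d ∈ D, 0 < p d)
    (hp1 : ∑ d ∈ D, p d = 1) : ∃ μ, IsSelfAffineMeasure D p μ := by
  have := isProbabilityMeasure_digitMeasure hp hp1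
  have hc : Measurable (code D) := (continuous_code hm hn D).measurable
  refine ⟨(Measure.infinitePi fun _ : ℕ => digitMeasure D p).map (code D),
    Measure.isProbabilityMeasure_map hc.aemeasurable, fun A hA => ?_⟩
  conv_lhs => rw [← sum_map_cons, Measure.map_apply hc hA]
  simp only [Measure.coe_finsetSum, Finset.sum_apply, Measure.smul_apply, smul_eq_mul]
  rw [← Finset.sum_coe_sort D]
  refine Finset.sum_congr rfl fun d _ => ?_
  rw [Measure.map_apply (measurable_cons d) (hc hA),
    Measure.map_apply hc ((continuous_T d.1).measurable hA)]
  congr 2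
  ext w
  simp only [mem_preimage, code_cons hm hn]

end BedfordMcMullen

/-! The problem is lifted to sequences of digits: `Λ` must be the range of `code` and `μ` the
push-forward of the Bernoulli measure (`IsCarpet.eq_range_code`, `IsSelfAffineMeasure.eq_map_code`).
The cells used there are the approximate squares `square w k`, which fix k row digits and l = `level
m n k` ≈ σk column digits. Their images have diameter of order m^(-k), and their mass is an explicit
product, `exp (logWeight p w k)`.

For each t the weights `tilt D p t` have digit exponents β(t) + t · (exponent for p), by
`digitExponent_tilt`. At typical points the local dimension is the mean of the digit exponents, so
the tilted measure has dimension β(t) + tα(t) where `μ` has local dimension α(t) = `meanExponent D p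
t`. Gibbs' inequality between two tilts shows that t is the unique minimizer of s ↦ α(t)s + β(s)
(`beta_add_lt`). The Legendre formula, the range of α(t), differentiability and concavity all follow
without differentiating β.

Lower bound (`dimH_levelSet_ge`): the strong law and the mass distribution principle. Without
separation a ball may meet neighbouring squares, but only if the sequence has a long run of extreme
digits. Typical sequences have no run of length proportional to k, since `D` meets two rows and two
columns.

Upper bound (`dimH_levelSet_le`): at an arbitrary point of the level set, the tilted mass of a
square differs from the expected one by a comparison of the averages of one function of the row
digits at times k and l. These averages cannot exceed their earlier values by a fixed ε at all large
k. For t ≥ 0 the relevant square may be a neighbour that changes with k; `frequently_avg_le` treats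
this, using that a carry forces extreme digits. -/

namespace BedfordMcMullen

/-! ### Expansions in an integer base -/

/-- The number with digits `a` in base `b`, the digit `a 0` standing before the point. -/
noncomputable def digitVal {b : ℕ} (a : ℕ → Fin b) : ℝ := ∑' k, ((a k : ℕ) : ℝ) * ((b : ℝ)⁻¹) ^ k

/-- The natural number whose base `b` digits are the first `k` terms of `a`. -/
def digitInt {b : ℕ} (a : ℕ → Fin b) : ℕ → ℕ
  | 0 => 0
  | k + 1 => b * digitInt a k + a k

theorem digitVal_eq {b : ℕ} (hb : 1 < b) (a : ℕ → Fin b) :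
    digitVal a = (a 0 : ℕ) + digitVal (fun s => a (s + 1)) / b := by
  rw [digitVal, (summable_digits hb a).tsum_eq_zero_add, digitVal, div_eq_mul_inv,
    ← tsum_mul_right]
  simp [pow_succ, mul_assoc]

theorem digitVal_nonneg {b : ℕ} (a : ℕ → Fin b) : 0 ≤ digitVal a :=
  tsum_nonneg fun k => by positivity

theorem digitVal_le {b : ℕ} (hb : 1 < b) (a : ℕ → Fin b) : digitVal a ≤ b := by
  have hb' : (1 : ℝ) < b := by exact_mod_cast hb
  have hs := summable_geometric_of_lt_one (r := (b : ℝ)⁻¹) (by positivity)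
    (inv_lt_one_of_one_lt₀ hb')
  have h := (summable_digits hb a).tsum_le_tsum (g := fun k => ((b : ℝ) - 1) * ((b : ℝ)⁻¹) ^ k)
    (fun k => ?_) (hs.mul_left _)
  · rw [tsum_mul_left, tsum_geometric_of_lt_one (by positivity) (inv_lt_one_of_one_lt₀ hb')] at h
    refine h.trans_eq ?_
    have : (b : ℝ) - 1 ≠ 0 := by linarith
    field_simp
  · gcongr
    have : ((a k : ℕ) : ℝ) + 1 ≤ b := by exact_mod_cast (a k).2
    linarith

/-- The extra factor `b` before the prefix integer comes from the digit before the point, which also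
makes `[0, b]` the range of `digitVal`. -/
theorem pow_mul_digitVal {b : ℕ} (hb : 1 < b) (a : ℕ → Fin b) (k : ℕ) :
    (b : ℝ) ^ k * digitVal a = b * digitInt a k + digitVal (fun s => a (s + k)) := by
  induction k with
  | zero => simp [digitInt]
  | succ k ih =>
    have hb' : (b : ℝ) ≠ 0 := by positivity
    rw [pow_succ, mul_right_comm, ih, digitVal_eq hb (fun s => a (s + k)), digitInt]
    simp only [zero_add, add_assoc, add_comm 1 k]
    push_cast
    field_simp
    ring

theorem digitInt_eq_iff {b : ℕ} (a a' : ℕ → Fin b) (k : ℕ) :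
    digitInt a k = digitInt a' k ↔ ∀ s < k, a s = a' s := by
  induction k with
  | zero => simp [digitInt]
  | succ k ih =>
    have key : digitInt a (k + 1) = digitInt a' (k + 1) ↔
        digitInt a k = digitInt a' k ∧ a k = a' k := by
      constructor
      · intro h
        have h1 := congrArg (· / b) h
        have h2 := congrArg (· % b) h
        have hb : 0 < b := (a 0).pos
        simp only [digitInt, Nat.mul_add_div hb, Nat.div_eq_of_lt (a k).2,
          Nat.div_eq_of_lt (a' k).2, Nat.mul_add_mod, Nat.mod_eq_of_lt (a k).2,
          Nat.mod_eq_of_lt (a' k).2, add_zero] at h1 h2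
        exact ⟨h1, Fin.ext h2⟩
      · rintro ⟨h1, h2⟩
        simp [digitInt, h1, h2]
    rw [key, ih]
    constructor
    · rintro ⟨h1, h2⟩ s hs
      rcases Nat.lt_succ_iff_lt_or_eq.1 hs with h | rfl
      exacts [h1 s h, h2]
    · exact fun h => ⟨fun s hs => h s (by omega), h k (by omega)⟩

/-- A first digit of at most `b - 2` would leave a distance of at least 1 to the right end `b`. So
it is maximal, and the tail satisfies the same estimate with one power fewer. -/
theorem digits_eq_last {b : ℕ} (hb : 1 < b) (j : ℕ) (a : ℕ → Fin b)
    (h : (b : ℝ) ^ j * (b - digitVal a) < b) : ∀ s < j, (a s : ℕ) + 1 = b := by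
  have hb' : (1 : ℝ) < b := by exact_mod_cast hb
  induction j generalizing a with
  | zero => simp
  | succ j ih =>
    have hv := digitVal_le hb (fun s => a (s + 1))
    have hj : (1 : ℝ) ≤ (b : ℝ) ^ j := one_le_pow₀ hb'.le
    have e : (b : ℝ) ^ (j + 1) * (b - digitVal a) = (b : ℝ) ^ j *
        ((b - digitVal fun s => a (s + 1)) + b * (b - 1 - (a 0 : ℕ))) := by
      rw [digitVal_eq hb a]
      field_simp
      ring
    rw [e] at h
    have h0 : (a 0 : ℕ) + 1 = b := by
      by_contra hne
      have h1 : (a 0 : ℕ) + 2 ≤ b := by have := (a 0).2; omega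
      have h2 : ((a 0 : ℕ) : ℝ) + 2 ≤ b := by exact_mod_cast h1
      have h3 : (b : ℝ) ≤ (b - digitVal fun s => a (s + 1)) + b * (b - 1 - (a 0 : ℕ)) := by
        nlinarith
      exact h.not_ge (h3.trans (le_mul_of_one_le_left (by linarith) hj))
    have h1 : ((a 0 : ℕ) : ℝ) + 1 = b := by exact_mod_cast h0
    have h2 := ih (fun s => a (s + 1)) (by
      rwa [show (b : ℝ) - 1 - (a 0 : ℕ) = 0 by linarith, mul_zero, add_zero] at h)
    intro s hs
    cases s with
    | zero => exact h0
    | succ s => exact h2 s (by omega)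

theorem digits_eq_zero {b : ℕ} (hb : 1 < b) (j : ℕ) (a : ℕ → Fin b)
    (h : (b : ℝ) ^ j * digitVal a < b) : ∀ s < j, (a s : ℕ) = 0 := by
  have hb' : (1 : ℝ) < b := by exact_mod_cast hb
  induction j generalizing a with
  | zero => simp
  | succ j ih =>
    have hv := digitVal_nonneg (fun s => a (s + 1))
    have hj : (1 : ℝ) ≤ (b : ℝ) ^ j := one_le_pow₀ hb'.le
    have e : (b : ℝ) ^ (j + 1) * digitVal a = (b : ℝ) ^ j *
        ((digitVal fun s => a (s + 1)) + b * (a 0 : ℕ)) := by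
      rw [digitVal_eq hb a]
      field_simp
      ring
    rw [e] at h
    have h0 : (a 0 : ℕ) = 0 := by
      by_contra hne
      have h1 : 1 ≤ (a 0 : ℕ) := by omega
      have h2 : 1 ≤ ((a 0 : ℕ) : ℝ) := by exact_mod_cast h1
      have h3 : (b : ℝ) ≤ (digitVal fun s => a (s + 1)) + b * (a 0 : ℕ) := by nlinarith
      exact h.not_ge (h3.trans (le_mul_of_one_le_left (by linarith) hj))
    have h2 := ih (fun s => a (s + 1)) (by
      rwa [h0, Nat.cast_zero, mul_zero, add_zero] at h)
    intro s hs
    cases s with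
    | zero => exact h0
    | succ s => exact h2 s (by omega)

/-- If two numbers are close, then their expansions agree, or the prefixes are neighbours and
the expansions come close to the common boundary. -/
theorem digitInt_of_abs_sub_lt {b : ℕ} (hb : 1 < b) (a a' : ℕ → Fin b) (k j : ℕ)
    (h : |digitVal a - digitVal a'| * (b : ℝ) ^ (k + j) < b) :
    digitInt a' k = digitInt a k ∨
    (digitInt a' k = digitInt a k + 1 ∧ ∀ s < j, (a (s + k) : ℕ) + 1 = b) ∨
    (digitInt a' k + 1 = digitInt a k ∧ ∀ s < j, (a (s + k) : ℕ) = 0) := by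
  have hb' : (1 : ℝ) < b := by exact_mod_cast hb
  have hj : (1 : ℝ) ≤ (b : ℝ) ^ j := one_le_pow₀ hb'.le
  have e := pow_mul_digitVal hb a k
  have e' := pow_mul_digitVal hb a' k
  have h0 := digitVal_nonneg (fun s => a (s + k))
  have h0' := digitVal_nonneg (fun s => a' (s + k))
  have h1 := digitVal_le hb (fun s => a (s + k))
  have h1' := digitVal_le hb (fun s => a' (s + k))
  set θ := digitVal (fun s => a (s + k)) with hθ
  set θ' := digitVal (fun s => a' (s + k)) with hθ'
  have hk : (0 : ℝ) < (b : ℝ) ^ k := by positivity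
  have hd : |(b * digitInt a k + θ) - (b * digitInt a' k + θ')| * (b : ℝ) ^ j < b := by
    rw [← e, ← e', ← mul_sub, abs_mul, abs_of_pos hk]
    calc _ = |digitVal a - digitVal a'| * (b : ℝ) ^ (k + j) := by rw [pow_add]; ring
      _ < b := h
  have hA : ((b * digitInt a k + θ) - (b * digitInt a' k + θ')) * (b : ℝ) ^ j < b :=
    (mul_le_mul_of_nonneg_right (le_abs_self _) (by positivity)).trans_lt hd
  have hB : ((b * digitInt a' k + θ') - (b * digitInt a k + θ)) * (b : ℝ) ^ j < b := by
    refine (mul_le_mul_of_nonneg_right ?_ (by positivity)).trans_lt hd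
    rw [abs_sub_comm]
    exact le_abs_self _
  rcases lt_trichotomy (digitInt a k) (digitInt a' k) with hlt | heq | hgt
  · right; left
    have h2 : digitInt a' k = digitInt a k + 1 := by
      -- Prefixes two apart give rescaled values at least `2 * b - b = b` apart, since each tail
      -- lies in `[0, b]`.
      by_contra hne
      have : digitInt a k + 2 ≤ digitInt a' k := by omega
      have : (digitInt a k : ℝ) + 2 ≤ digitInt a' k := by exact_mod_cast this
      have h3 : (b : ℝ) ≤ (b * digitInt a' k + θ') - (b * digitInt a k + θ) := by nlinarith
      exact hB.not_ge (h3.trans (le_mul_of_one_le_right (by linarith) hj))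
    refine ⟨h2, digits_eq_last hb j (fun s => a (s + k)) ?_⟩
    rw [h2] at hB
    push_cast at hB
    rw [← hθ]
    nlinarith
  · exact Or.inl heq.symm
  · right; right
    have h2 : digitInt a' k + 1 = digitInt a k := by
      by_contra hne
      have : digitInt a' k + 2 ≤ digitInt a k := by omega
      have : (digitInt a' k : ℝ) + 2 ≤ digitInt a k := by exact_mod_cast this
      have h3 : (b : ℝ) ≤ (b * digitInt a k + θ) - (b * digitInt a' k + θ') := by nlinarith
      exact hA.not_ge (h3.trans (le_mul_of_one_le_right (by linarith) hj))
    refine ⟨h2, digits_eq_zero hb j (fun s => a (s + k)) ?_⟩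
    rw [← h2] at hA
    push_cast at hA
    rw [← hθ]
    nlinarith

/-! ### The coding map -/

section Coding

variable {m n : ℕ} {D : Finset (Fin m × Fin n)}

/-- The row digits of a symbolic point. -/
def rowDigits (w : ℕ → D) : ℕ → Fin m := fun k => (w k).1.1

/-- The column digits of a symbolic point. -/
def colDigits (w : ℕ → D) : ℕ → Fin n := fun k => (w k).1.2

theorem code_zero (w : ℕ → D) : code D w 0 = digitVal (colDigits w) := rfl

theorem code_one (w : ℕ → D) : code D w 1 = digitVal (rowDigits w) := rfl

/-- The composition `T (w 0) ∘ ⋯ ∘ T (w (k - 1))`. -/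
noncomputable def iterT : ℕ → (ℕ → D) → EuclideanSpace ℝ (Fin 2) → EuclideanSpace ℝ (Fin 2)
  | 0, _, z => z
  | k + 1, w, z => T (w 0).1 (iterT k (fun s => w (s + 1)) z)

theorem iterT_zero_sub_code (hn : 1 < n) (k : ℕ) (w : ℕ → D)
    (z : EuclideanSpace ℝ (Fin 2)) :
    iterT k w z 0 - code D w 0 = (z 0 - code D (fun s => w (s + k)) 0) / (n : ℝ) ^ k := by
  induction k generalizing w with
  | zero => simp [iterT]
  | succ k ih =>
    have h := ih (fun s => w (s + 1))
    have hn' : (n : ℝ) ≠ 0 := by positivity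
    have e : code D w 0 = code D (fun s => w (s + 1)) 0 / n + ((w 0).1.2 : ℕ) := by
      rw [code_zero, digitVal_eq hn, add_comm]; rfl
    have e' : iterT (k + 1) w z 0 = iterT k (fun s => w (s + 1)) z 0 / n + ((w 0).1.2 : ℕ) := by
      simp [iterT, T]
    simp only [add_assoc] at h
    rw [e, e', add_sub_add_right_eq_sub, ← sub_div, h, pow_succ, div_div]

theorem iterT_one_sub_code (hm : 1 < m) (k : ℕ) (w : ℕ → D)
    (z : EuclideanSpace ℝ (Fin 2)) :
    iterT k w z 1 - code D w 1 = (z 1 - code D (fun s => w (s + k)) 1) / (m : ℝ) ^ k := by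
  induction k generalizing w with
  | zero => simp [iterT]
  | succ k ih =>
    have h := ih (fun s => w (s + 1))
    have hm' : (m : ℝ) ≠ 0 := by positivity
    have e : code D w 1 = code D (fun s => w (s + 1)) 1 / m + ((w 0).1.1 : ℕ) := by
      rw [code_one, digitVal_eq hm, add_comm]; rfl
    have e' : iterT (k + 1) w z 1 = iterT k (fun s => w (s + 1)) z 1 / m + ((w 0).1.1 : ℕ) := by
      simp [iterT, T]
    simp only [add_assoc] at h
    rw [e, e', add_sub_add_right_eq_sub, ← sub_div, h, pow_succ, div_div]

theorem tendsto_euclidean {ι : Type*} {l : Filter ι} {f : ι → EuclideanSpace ℝ (Fin 2)}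
    {x : EuclideanSpace ℝ (Fin 2)} (h0 : Tendsto (fun i => f i 0) l (𝓝 (x 0)))
    (h1 : Tendsto (fun i => f i 1) l (𝓝 (x 1))) : Tendsto f l (𝓝 x) := by
  have h : Tendsto (fun i => WithLp.ofLp (f i)) l (𝓝 (WithLp.ofLp x)) := by
    refine tendsto_pi_nhds.2 fun j => ?_
    fin_cases j
    exacts [h0, h1]
  exact ((PiLp.continuous_toLp 2 (fun _ : Fin 2 => ℝ)).tendsto (WithLp.ofLp x)).comp h

theorem tendsto_div_pow {b : ℕ} (hb : 1 < b) {u : ℕ → ℝ} {R : ℝ} (hu : ∀ k, |u k| ≤ R) :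
    Tendsto (fun k => u k / (b : ℝ) ^ k) atTop (𝓝 0) := by
  have hb' : (1 : ℝ) < b := by exact_mod_cast hb
  have h := (tendsto_inv_atTop_zero.comp (tendsto_pow_atTop_atTop_of_one_lt hb')).const_mul R
  rw [mul_zero] at h
  refine squeeze_zero_norm (fun k => ?_) h
  rw [norm_div, Real.norm_eq_abs, norm_pow, Real.norm_natCast, div_eq_mul_inv]
  exact mul_le_mul_of_nonneg_right (hu k) (by positivity)

/-- The base point may vary with `k`; this is what lets a backward orbit in the carpet be followed.
-/
theorem tendsto_iterT (hm : 1 < m) (hn : 1 < n) (w : ℕ → D)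
    {z : ℕ → EuclideanSpace ℝ (Fin 2)} {R : ℝ} (hz : ∀ k, ‖z k‖ ≤ R) :
    Tendsto (fun k => iterT k w (z k)) atTop (𝓝 (code D w)) := by
  refine tendsto_euclidean ?_ ?_
  · rw [tendsto_iff_norm_sub_tendsto_zero, ← tendsto_zero_iff_norm_tendsto_zero]
    simp only [iterT_zero_sub_code hn]
    refine tendsto_div_pow hn (R := R + n) fun k => (abs_sub _ _).trans (add_le_add ?_ ?_)
    · exact (PiLp.norm_apply_le (z k) 0).trans (hz k)
    · rw [code_zero, abs_of_nonneg (digitVal_nonneg _)]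
      exact digitVal_le hn _
  · rw [tendsto_iff_norm_sub_tendsto_zero, ← tendsto_zero_iff_norm_tendsto_zero]
    simp only [iterT_one_sub_code hm]
    refine tendsto_div_pow hm (R := R + m) fun k => (abs_sub _ _).trans (add_le_add ?_ ?_)
    · exact (PiLp.norm_apply_le (z k) 1).trans (hz k)
    · rw [code_one, abs_of_nonneg (digitVal_nonneg _)]
      exact digitVal_le hm _

/-! ### Uniqueness of the carpet -/

theorem iterT_mem {Λ : Set (EuclideanSpace ℝ (Fin 2))} (hΛ : IsCarpet D Λ) (k : ℕ) (w : ℕ → D)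
    {z : EuclideanSpace ℝ (Fin 2)} (hz : z ∈ Λ) : iterT k w z ∈ Λ := by
  induction k generalizing w with
  | zero => exact hz
  | succ k ih =>
    rw [← hΛ.iUnion_eq]
    exact mem_biUnion (w 0).2 (mem_image_of_mem _ (ih _))

theorem IsCarpet.eq_range_code (hm : 1 < m) (hn : 1 < n) {Λ : Set (EuclideanSpace ℝ (Fin 2))}
    (hΛ : IsCarpet D Λ) : Λ = range (code D) := by
  obtain ⟨R, hR⟩ := hΛ.isCompact.isBounded.exists_norm_le
  refine Subset.antisymm (fun x hx => ?_) ?_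
  · have step : ∀ y : Λ, ∃ dz : D × Λ, T dz.1.1 dz.2.1 = y.1 := by
      rintro ⟨y, hy⟩
      rw [← hΛ.iUnion_eq] at hy
      simp only [mem_iUnion, mem_image] at hy
      obtain ⟨d, hd, z, hz, rfl⟩ := hy
      exact ⟨(⟨d, hd⟩, ⟨z, hz⟩), rfl⟩
    choose g hg using step
    -- A backward orbit of `x` in `Λ`: each point is the image of the next under the chosen digit
    -- map, and the chosen digits code `x`.
    let z : ℕ → Λ := fun k => Nat.rec ⟨x, hx⟩ (fun _ y => (g y).2) k
    have hx' : ∀ k s, iterT k (fun i => (g (z (i + s))).1) (z (k + s)).1 = (z s).1 := by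
      intro k
      induction k with
      | zero => intro s; simp [iterT]
      | succ k ih =>
        intro s
        have h := ih (s + 1)
        simp only [iterT, zero_add]
        rw [← hg (z s)]
        have e : (fun i => (g (z (i + 1 + s))).1) = fun i => (g (z (i + (s + 1)))).1 := by
          funext i; rw [add_assoc, add_comm 1 s]
        rw [e, show k + 1 + s = k + (s + 1) by ring, h]
    refine ⟨fun i => (g (z i)).1, ?_⟩
    have h := tendsto_iterT hm hn (fun i => (g (z i)).1) (z := fun k => (z k).1)
      (fun k => hR _ (z k).2)
    have h' : ∀ k, iterT k (fun i => (g (z i)).1) (z k).1 = x := fun k => by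
      have h0 := hx' k 0
      simp only [add_zero] at h0
      exact h0
    simp only [h'] at h
    exact tendsto_nhds_unique h tendsto_const_nhds
  · rintro _ ⟨w, rfl⟩
    obtain ⟨z, hz⟩ := hΛ.nonempty
    exact hΛ.isCompact.isClosed.mem_of_tendsto
      (tendsto_iterT hm hn w (z := fun _ => z) (fun _ => hR _ hz))
      (Eventually.of_forall fun k => iterT_mem hΛ k w hz)

/-! ### Uniqueness of the self-affine measure -/

theorem measurable_iterT (k : ℕ) :
    Measurable fun x : (ℕ → D) × EuclideanSpace ℝ (Fin 2) => iterT k x.1 x.2 := by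
  induction k with
  | zero => exact measurable_snd
  | succ k ih =>
    have h1 : Measurable fun x : D × EuclideanSpace ℝ (Fin 2) => T x.1.1 x.2 :=
      measurable_from_prod_countable_right fun d => (continuous_T d.1).measurable
    have h2 : Measurable fun x : (ℕ → D) × EuclideanSpace ℝ (Fin 2) =>
        ((fun s => x.1 (s + 1) : ℕ → D), x.2) :=
      (measurable_pi_lambda _ fun s => (measurable_pi_apply (s + 1)).comp measurable_fst).prodMk
        measurable_snd
    exact h1.comp (((measurable_pi_apply 0).comp measurable_fst).prodMk (ih.comp h2))

/-- The Bernoulli measure on the symbolic space. -/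
noncomputable def bernoulli (D : Finset (Fin m × Fin n)) (p : Fin m × Fin n → ℝ) :
    Measure (ℕ → D) :=
  Measure.infinitePi fun _ : ℕ => digitMeasure D p

instance {p : Fin m × Fin n → ℝ} [IsProbabilityMeasure (digitMeasure D p)] :
    IsProbabilityMeasure (bernoulli D p) := by
  rw [bernoulli]; infer_instance

variable {p : Fin m × Fin n → ℝ}

theorem IsSelfAffineMeasure.lintegral_comp_T {μ : Measure (EuclideanSpace ℝ (Fin 2))}
    (hμ : IsSelfAffineMeasure D p μ) {g : EuclideanSpace ℝ (Fin 2) → ENNReal}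
    (hg : Measurable g) :
    ∑ d : D, ENNReal.ofReal (p d) * ∫⁻ z, g (T d.1 z) ∂μ = ∫⁻ z, g z ∂μ := by
  have h : μ = ∑ d : D, ENNReal.ofReal (p d) • μ.map (T d.1) := by
    ext A hA
    rw [hμ.measure_eq A hA, ← Finset.sum_coe_sort D]
    simp only [Measure.coe_finsetSum, Finset.sum_apply, Measure.smul_apply, smul_eq_mul]
    exact Finset.sum_congr rfl fun d _ => by
      rw [Measure.map_apply (continuous_T d.1).measurable hA]
  conv_rhs => rw [h]
  rw [lintegral_finsetSum_measure]
  exact Finset.sum_congr rfl fun d _ => by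
    rw [lintegral_smul_measure, lintegral_map hg (continuous_T d.1).measurable, smul_eq_mul]

/-- The Bernoulli measure is reproduced by prepending a random digit (`sum_map_cons`), so each
induction step absorbs one application of self-affinity. -/
theorem IsSelfAffineMeasure.lintegral_iterT [IsProbabilityMeasure (digitMeasure D p)]
    {μ : Measure (EuclideanSpace ℝ (Fin 2))} (hμ : IsSelfAffineMeasure D p μ) (k : ℕ)
    {g : EuclideanSpace ℝ (Fin 2) → ENNReal} (hg : Measurable g) :
    ∫⁻ w, ∫⁻ z, g (iterT k w z) ∂μ ∂bernoulli D p = ∫⁻ z, g z ∂μ := by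
  have := hμ.isProbabilityMeasure
  induction k generalizing g with
  | zero => simp [iterT]
  | succ k ih =>
    have hmeas : Measurable fun w : ℕ → D => ∫⁻ z, g (iterT (k + 1) w z) ∂μ :=
      Measurable.lintegral_prod_right' (f := fun x : (ℕ → D) × _ => g (iterT (k + 1) x.1 x.2))
        (hg.comp (measurable_iterT (k + 1)))
    rw [bernoulli, ← sum_map_cons, lintegral_finsetSum_measure, ← hμ.lintegral_comp_T hg]
    refine Finset.sum_congr rfl fun d _ => ?_
    rw [lintegral_smul_measure, lintegral_map hmeas (measurable_cons d), smul_eq_mul]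
    exact congrArg _ (ih (hg.comp (continuous_T d.1).measurable))

/-- As k grows, `iterT k w z` forgets `z` and tends to `code D w`. Dominated convergence, in `z` and
then in `w`, turns the iterated invariance into the claim for bounded continuous functions, which
determine the measure. -/
theorem IsSelfAffineMeasure.eq_map_code (hm : 1 < m) (hn : 1 < n)
    [IsProbabilityMeasure (digitMeasure D p)]
    {μ : Measure (EuclideanSpace ℝ (Fin 2))} (hμ : IsSelfAffineMeasure D p μ) :
    μ = (bernoulli D p).map (code D) := by
  have := hμ.isProbabilityMeasure
  have hc : Measurable (code D) := (continuous_code hm hn D).measurable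
  have := Measure.isProbabilityMeasure_map (μ := bernoulli D p) hc.aemeasurable
  refine ext_of_forall_lintegral_eq_of_IsFiniteMeasure fun f => ?_
  have hf : Measurable fun x => (f x : ENNReal) := f.continuous.measurable.coe_nnreal_ennreal
  obtain ⟨C, hC⟩ : ∃ C : NNReal, ∀ x, f x ≤ C :=
    ⟨nndist f 0, BoundedContinuousFunction.NNReal.upper_bound f⟩
  have h1 : ∀ w, Tendsto (fun k => ∫⁻ z, f (iterT k w z) ∂μ) atTop (𝓝 (f (code D w))) := by
    intro w
    have h := tendsto_lintegral_of_dominated_convergence (μ := μ)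
      (F := fun k z => (f (iterT k w z) : ENNReal)) (f := fun _ => (f (code D w) : ENNReal))
      (fun _ => (C : ENNReal))
      (fun k => hf.comp ((measurable_iterT k).comp measurable_prodMk_left))
      (fun k => Eventually.of_forall fun z => ENNReal.coe_le_coe.2 (hC _))
      (by simp)
      (Eventually.of_forall fun z => ENNReal.tendsto_coe.2
        ((f.continuous.tendsto _).comp
          (tendsto_iterT hm hn w (z := fun _ => z) (R := ‖z‖) fun _ => le_rfl)))
    simpa using h
  have h2 := tendsto_lintegral_of_dominated_convergence (μ := bernoulli D p)
    (F := fun k w => ∫⁻ z, (f (iterT k w z) : ENNReal) ∂μ)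
    (f := fun w => (f (code D w) : ENNReal)) (fun _ => (C : ENNReal))
    (fun k => Measurable.lintegral_prod_right'
      (f := fun x : (ℕ → D) × _ => (f (iterT k x.1 x.2) : ENNReal))
        (hf.comp (measurable_iterT k)))
    (fun k => Eventually.of_forall fun w =>
      (lintegral_mono (g := fun _ => (C : ENNReal)) fun z => ENNReal.coe_le_coe.2 (hC _)).trans
        (by simp))
    (by simp) (Eventually.of_forall h1)
  simp only [hμ.lintegral_iterT _ hf] at h2
  rw [lintegral_map hf hc]
  exact tendsto_nhds_unique tendsto_const_nhds h2

end Coding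

/-! ### Approximate squares -/

/-- The number `l` of column digits with `n ^ (-l) ≈ m ^ (-k)`. -/
def level (m n k : ℕ) : ℕ := Nat.log n (m ^ k)

section Level

variable {m n : ℕ}

theorem pow_level_le (hm : 1 < m) (k : ℕ) : n ^ level m n k ≤ m ^ k :=
  Nat.pow_log_le_self n (by positivity)

theorem lt_pow_level_succ (hn : 1 < n) (k : ℕ) : m ^ k < n ^ (level m n k + 1) :=
  Nat.lt_pow_succ_log_self hn _

theorem level_le (hm : 1 < m) (hmn : m < n) (k : ℕ) : level m n k ≤ k := by
  have h := pow_level_le (n := n) hm k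
  by_contra! hk
  have h1 : n ^ k < n ^ level m n k := Nat.pow_lt_pow_right (by omega) hk
  have h2 : m ^ k ≤ n ^ k := Nat.pow_le_pow_left hmn.le k
  omega

theorem sigma_pos (hm : 1 < m) (hmn : m < n) : 0 < sigma m n :=
  div_pos (Real.log_pos (by exact_mod_cast hm)) (Real.log_pos (by exact_mod_cast hm.trans hmn))

theorem sigma_lt_one (hm : 1 < m) (hmn : m < n) : sigma m n < 1 := by
  have hm' : (1 : ℝ) < m := by exact_mod_cast hm
  have h : (m : ℝ) < n := by exact_mod_cast hmn
  rw [sigma, div_lt_one (Real.log_pos (by linarith))]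
  exact Real.log_lt_log (by linarith) h

theorem level_le_sigma_mul (hm : 1 < m) (hmn : m < n) (k : ℕ) :
    (level m n k : ℝ) ≤ sigma m n * k := by
  have hn : 0 < Real.log n := Real.log_pos (by exact_mod_cast hm.trans hmn)
  have h : ((n : ℝ) ^ level m n k) ≤ (m : ℝ) ^ k := by exact_mod_cast pow_level_le hm k
  have h' := Real.log_le_log (pow_pos (by norm_cast; omega) _) h
  rw [Real.log_pow, Real.log_pow] at h'
  rw [sigma, div_mul_eq_mul_div, le_div_iff₀ hn]
  linarith

theorem sigma_mul_lt_level (hm : 1 < m) (hmn : m < n) (k : ℕ) :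
    sigma m n * k < level m n k + 1 := by
  have hn : 0 < Real.log n := Real.log_pos (by exact_mod_cast hm.trans hmn)
  have h : ((m : ℝ) ^ k) < (n : ℝ) ^ (level m n k + 1) := by
    exact_mod_cast lt_pow_level_succ (hm.trans hmn) k
  have h' := Real.log_lt_log (pow_pos (by norm_cast; omega) _) h
  rw [Real.log_pow, Real.log_pow] at h'
  rw [sigma, div_mul_eq_mul_div, div_lt_iff₀ hn]
  push_cast at h'
  linarith

theorem tendsto_level (hm : 1 < m) (hmn : m < n) :
    Tendsto (fun k => level m n k) atTop atTop := by
  have hσ := sigma_pos hm hmn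
  rw [← tendsto_natCast_atTop_iff (R := ℝ)]
  refine tendsto_atTop_mono (fun k => (sub_le_iff_le_add.2 (sigma_mul_lt_level hm hmn k).le)) ?_
  exact tendsto_atTop_add_const_right _ (-1 : ℝ)
    (tendsto_natCast_atTop_atTop.const_mul_atTop hσ)

theorem tendsto_level_div (hm : 1 < m) (hmn : m < n) :
    Tendsto (fun k : ℕ => (level m n k : ℝ) / k) atTop (𝓝 (sigma m n)) := by
  have h1 : Tendsto (fun k : ℕ => sigma m n - 1 / (k : ℝ)) atTop (𝓝 (sigma m n)) := by
    simpa using (tendsto_const_nhds (x := sigma m n)).sub tendsto_one_div_atTop_nhds_zero_nat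
  refine tendsto_of_tendsto_of_tendsto_of_le_of_le' h1 tendsto_const_nhds ?_ ?_
  · filter_upwards [eventually_gt_atTop 0] with k hk
    have hk' : (0 : ℝ) < k := by exact_mod_cast hk
    have := sigma_mul_lt_level hm hmn k
    rw [le_div_iff₀ hk', sub_mul, one_div, inv_mul_cancel₀ hk'.ne']
    linarith
  · filter_upwards [eventually_gt_atTop 0] with k hk
    have hk' : (0 : ℝ) < k := by exact_mod_cast hk
    rw [div_le_iff₀ hk']
    exact level_le_sigma_mul hm hmn k

end Level

section Square

variable {m n : ℕ} {D : Finset (Fin m × Fin n)}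

/-- The approximate square of level `k` around `w`. -/
def square (w : ℕ → D) (k : ℕ) : Set (ℕ → D) :=
  {w' | (∀ s < k, rowDigits w' s = rowDigits w s) ∧
    ∀ s < level m n k, colDigits w' s = colDigits w s}

theorem mem_square_iff {w w' : ℕ → D} {k : ℕ} : w' ∈ square w k ↔
    digitInt (rowDigits w') k = digitInt (rowDigits w) k ∧
    digitInt (colDigits w') (level m n k) = digitInt (colDigits w) (level m n k) := by
  rw [digitInt_eq_iff, digitInt_eq_iff]; rfl

/-- The logarithm of the measure of an approximate square. -/
noncomputable def logWeight (p : Fin m × Fin n → ℝ) (w : ℕ → D) (k : ℕ) : ℝ :=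
  ∑ s ∈ Finset.range k,
    if s < level m n k then Real.log (p (w s)) else Real.log (q D p (w s).1.1)

variable {p : Fin m × Fin n → ℝ}

theorem q_pos (hp : ∀ d ∈ D, 0 < p d) (d : D) : 0 < q D p d.1.1 :=
  Finset.sum_pos (fun e he => hp e (Finset.mem_filter.1 he).1) ⟨d.1, by simp⟩

theorem digitMeasure_apply (S : Set D) [DecidablePred (· ∈ S)] :
    digitMeasure D p S = ∑ d : D, if d ∈ S then ENNReal.ofReal (p d) else 0 := by
  simp only [digitMeasure, Measure.coe_finsetSum, Finset.sum_apply, Measure.smul_apply,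
    smul_eq_mul, Measure.dirac_apply, indicator_apply, Pi.one_apply, mul_ite, mul_one, mul_zero]

theorem digitMeasure_singleton (d : D) : digitMeasure D p {d} = ENNReal.ofReal (p d) := by
  classical
  simp [digitMeasure_apply]

theorem digitMeasure_row (hp : ∀ d ∈ D, 0 < p d) (i : Fin m) :
    digitMeasure D p {d | d.1.1 = i} = ENNReal.ofReal (q D p i) := by
  classical
  rw [digitMeasure_apply, q, ENNReal.ofReal_sum_of_nonneg fun d hd =>
    (hp d (Finset.mem_filter.1 hd).1).le, Finset.sum_filter,
    ← Finset.sum_coe_sort D (fun d => if d.1 = i then ENNReal.ofReal (p d) else 0)]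
  rfl

/-- Since `level m n k ≤ k`, the square is a product set: a single digit is prescribed before time
`level m n k` and a whole row of digits from then up to `k`. -/
theorem bernoulli_square (hm : 1 < m) (hmn : m < n) (hp : ∀ d ∈ D, 0 < p d)
    [IsProbabilityMeasure (digitMeasure D p)] (w : ℕ → D) (k : ℕ) :
    bernoulli D p (square w k) = ENNReal.ofReal (Real.exp (logWeight p w k)) := by
  have hl := level_le hm hmn k
  have e : square w k = Set.pi (Finset.range k : Set ℕ) fun s =>
      if s < level m n k then {w s} else {d | d.1.1 = (w s).1.1} := by
    ext w'
    simp only [square, mem_ofPred_eq, Set.mem_pi, Finset.mem_coe, Finset.mem_range]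
    constructor
    · rintro ⟨h1, h2⟩ s hs
      split_ifs with h
      · exact Subtype.ext (Prod.ext (h1 s hs) (h2 s h))
      · exact h1 s hs
    · refine fun h => ⟨fun s hs => ?_, fun s hs => ?_⟩
      · have := h s hs
        split_ifs at this with h'
        · exact congrArg (fun d : D => d.1.1) this
        · exact this
      · have := h s (hs.trans_le hl)
        rw [if_pos hs] at this
        exact congrArg (fun d : D => d.1.2) this
  rw [e, bernoulli, Measure.infinitePi_pi _ fun s _ => (Set.toFinite _).measurableSet, logWeight,
    Real.exp_sum, ENNReal.ofReal_prod_of_nonneg fun _ _ => (Real.exp_pos _).le]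
  refine Finset.prod_congr rfl fun s _ => ?_
  split_ifs
  · rw [digitMeasure_singleton, Real.exp_log (hp _ (w s).2)]
  · rw [digitMeasure_row hp, Real.exp_log (q_pos hp (w s))]

theorem bernoulli_real_square (hm : 1 < m) (hmn : m < n) (hp : ∀ d ∈ D, 0 < p d)
    [IsProbabilityMeasure (digitMeasure D p)] (w : ℕ → D) (k : ℕ) :
    (bernoulli D p).real (square w k) = Real.exp (logWeight p w k) := by
  rw [measureReal_def, bernoulli_square hm hmn hp, ENNReal.toReal_ofReal (Real.exp_pos _).le]

theorem dist_le_add (x y : EuclideanSpace ℝ (Fin 2)) :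
    dist x y ≤ |x 0 - y 0| + |x 1 - y 1| := by
  rw [EuclideanSpace.dist_eq, Fin.sum_univ_two, Real.dist_eq, Real.dist_eq]
  refine Real.sqrt_le_iff.2 ⟨by positivity, ?_⟩
  nlinarith [abs_nonneg (x 0 - y 0), abs_nonneg (x 1 - y 1)]

theorem abs_sub_le_dist (x y : EuclideanSpace ℝ (Fin 2)) (i : Fin 2) :
    |x i - y i| ≤ dist x y := by
  rw [dist_eq_norm]
  exact PiLp.norm_apply_le (x - y) i

theorem abs_digitVal_sub_le {b : ℕ} (hb : 1 < b) {a a' : ℕ → Fin b} {k : ℕ}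
    (h : digitInt a k = digitInt a' k) : |digitVal a - digitVal a'| * (b : ℝ) ^ k ≤ b := by
  have hk : (0 : ℝ) < (b : ℝ) ^ k := by positivity
  have e := pow_mul_digitVal hb a k
  have e' := pow_mul_digitVal hb a' k
  rw [← abs_of_pos hk, ← abs_mul, sub_mul, mul_comm _ ((b : ℝ) ^ k), e,
    mul_comm _ ((b : ℝ) ^ k), e', h, abs_le]
  have := digitVal_nonneg (fun s => a (s + k))
  have := digitVal_nonneg (fun s => a' (s + k))
  have := digitVal_le hb (fun s => a (s + k))
  have := digitVal_le hb (fun s => a' (s + k))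
  constructor <;> linarith

theorem dist_code_le_of_mem_square (hm : 1 < m) (hmn : m < n) {w w' : ℕ → D} {k : ℕ}
    (h : w' ∈ square w k) : dist (code D w') (code D w) ≤ 2 * n ^ 2 * ((m : ℝ)⁻¹) ^ k := by
  have hn := hm.trans hmn
  rw [mem_square_iff] at h
  have h1 := abs_digitVal_sub_le hm h.1
  have h0 := abs_digitVal_sub_le hn h.2
  have hk : (0 : ℝ) < (m : ℝ) ^ k := by positivity
  have hl : (m : ℝ) ^ k ≤ (n : ℝ) ^ level m n k * n := by
    have := (lt_pow_level_succ (m := m) hn k).le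
    rw [pow_succ] at this
    exact_mod_cast this
  have hmn' : (m : ℝ) ≤ n := by exact_mod_cast hmn.le
  have hn1 : (1 : ℝ) ≤ n := by exact_mod_cast hn.le
  refine (dist_le_add _ _).trans ?_
  rw [inv_pow, ← div_eq_mul_inv, le_div_iff₀ hk, code_zero, code_zero, code_one, code_one,
    add_mul]
  have h2 : |digitVal (colDigits w') - digitVal (colDigits w)| * (m : ℝ) ^ k ≤ n * n := by
    refine (mul_le_mul_of_nonneg_left hl (abs_nonneg _)).trans ?_
    rw [← mul_assoc]
    gcongr
  nlinarith

/-- Pigeonhole: the ball meets at most three row prefixes and three column prefixes, hence nine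
squares. The radius has exponent `k + 2` so that a change of row prefix forces two extreme row
digits, as `IsNeighbour` requires. -/
theorem exists_square_near (hm : 1 < m) (hmn : m < n)
    [IsProbabilityMeasure (digitMeasure D p)] (w : ℕ → D) (k : ℕ) :
    ∃ w' : ℕ → D, dist (code D w') (code D w) ≤ ((m : ℝ)⁻¹) ^ (k + 2) ∧
      (bernoulli D p).real (code D ⁻¹' Metric.closedBall (code D w) (((m : ℝ)⁻¹) ^ (k + 2))) ≤
        9 * (bernoulli D p).real (square w' k) := by
  have hn := hm.trans hmn
  set r := ((m : ℝ)⁻¹) ^ (k + 2) with hr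
  have hr0 : 0 < r := by positivity
  set B := code D ⁻¹' Metric.closedBall (code D w) r with hB
  by_contra! H
  have hwB := H w (by simpa using hr0.le)
  have hB0 : 0 < (bernoulli D p).real B :=
    (mul_nonneg (by norm_num) measureReal_nonneg).trans_lt hwB
  let N := digitInt (rowDigits w) k
  let M := digitInt (colDigits w) (level m n k)
  let F : Finset (ℕ × ℕ) := {N, N + 1, N - 1} ×ˢ {M, M + 1, M - 1}
  let S : ℕ × ℕ → Set (ℕ → D) := fun ab => {w' | digitInt (rowDigits w') k = ab.1 ∧
    digitInt (colDigits w') (level m n k) = ab.2}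
  have hcov : B ⊆ ⋃ ab ∈ F, B ∩ S ab := by
    intro w' hw'
    have hd : dist (code D w) (code D w') ≤ r := by
      rw [dist_comm]; exact hw'
    have hmr : r * (m : ℝ) ^ (k + 2) = 1 := by
      rw [hr, inv_pow, inv_mul_cancel₀ (by positivity)]
    have h1 := digitInt_of_abs_sub_lt hm (rowDigits w) (rowDigits w') k 2 (by
      refine (mul_le_mul_of_nonneg_right ((abs_sub_le_dist _ _ 1).trans hd)
        (by positivity)).trans_lt ?_
      rw [hmr]
      exact_mod_cast hm)
    have h0 := digitInt_of_abs_sub_lt hn (colDigits w) (colDigits w') (level m n k) 0 (by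
      refine (mul_le_mul_of_nonneg_right ((abs_sub_le_dist _ _ 0).trans hd)
        (by positivity)).trans_lt ?_
      have hl : (n : ℝ) ^ (level m n k + 0) ≤ (m : ℝ) ^ (k + 2) := by
        refine le_trans (by exact_mod_cast pow_level_le hm k)
          (pow_le_pow_right₀ (by exact_mod_cast hm.le) (by omega : k ≤ k + 2))
      refine (mul_le_mul_of_nonneg_left hl hr0.le).trans_lt ?_
      rw [hmr]
      exact_mod_cast hn)
    simp only [mem_iUnion]
    refine ⟨(digitInt (rowDigits w') k, digitInt (colDigits w') (level m n k)), ?_, hw',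
      rfl, rfl⟩
    simp only [F, Finset.mem_product, Finset.mem_insert, Finset.mem_singleton, N, M]
    omega
  have hterm : ∀ ab ∈ F, (bernoulli D p).real (B ∩ S ab) < (bernoulli D p).real B / 9 := by
    intro ab _
    rcases (B ∩ S ab).eq_empty_or_nonempty with h | ⟨w', hw', hS⟩
    · rw [h, measureReal_empty]
      positivity
    · have h := H w' hw'
      have e : S ab ⊆ square w' k := fun v hv =>
        mem_square_iff.2 ⟨hv.1.trans hS.1.symm, hv.2.trans hS.2.symm⟩
      have h' : (bernoulli D p).real (B ∩ S ab) ≤ (bernoulli D p).real (square w' k) :=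
        measureReal_mono (inter_subset_right.trans e)
      linarith
  have hcard : F.card ≤ 9 := by
    rw [Finset.card_product]
    exact Nat.mul_le_mul Finset.card_le_three Finset.card_le_three
  have hF : F.Nonempty := ⟨(N, M), by simp [F]⟩
  have h1 : (bernoulli D p).real B ≤ ∑ ab ∈ F, (bernoulli D p).real (B ∩ S ab) :=
    (measureReal_mono hcov (measure_ne_top _ _)).trans (measureReal_biUnion_finset_le _ _)
  have h2 := Finset.sum_lt_sum_of_nonempty hF hterm
  rw [Finset.sum_const, nsmul_eq_mul] at h2
  have h3 : (F.card : ℝ) ≤ 9 := by exact_mod_cast hcard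
  have h4 : (F.card : ℝ) * ((bernoulli D p).real B / 9) ≤ 9 * ((bernoulli D p).real B / 9) := by
    gcongr
  linarith

end Square

/-! ### Tilted weights and the Legendre transform of `beta` -/

/-- A function that is given by minimizing `α * t + β t`, with unique minimizers, is
differentiable and concave. -/
theorem differentiableOn_and_concaveOn_of_minimizers {a β F : ℝ → ℝ} {I : Set ℝ}
    (hI : IsOpen I) (hI' : Convex ℝ I)
    (h : ∀ t s, t ≠ s → β t + t * a t < β s + s * a t)
    (hF : ∀ α ∈ I, ∃ t, a t = α ∧ F α = α * t + β t) :
    DifferentiableOn ℝ F I ∧ ConcaveOn ℝ I F := by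
  have hle : ∀ α ∈ I, ∀ s, F α ≤ α * s + β s := by
    intro α hα s
    obtain ⟨t, rfl, e⟩ := hF α hα
    rw [e]
    rcases eq_or_ne t s with rfl | hts
    · exact le_rfl
    · linarith [h t s hts]
  have hanti : ∀ t s, t < s → a s < a t := by
    intro t s hts
    have h1 := h t s hts.ne
    have h2 := h s t hts.ne'
    nlinarith
  constructor
  · intro α₀ hα₀
    obtain ⟨t₀, ht₀, e₀⟩ := hF α₀ hα₀
    -- Envelope principle: the derivative is the minimizer.
    have hd : HasDerivAt F t₀ α₀ := by
      rw [hasDerivAt_iff_isLittleO, Asymptotics.isLittleO_iff]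
      intro c hc
      -- As `a` is strictly decreasing, every `α` in this interval has its minimizer within `c` of
      -- `t₀`.
      have hnhds : Ioo (a (t₀ + c)) (a (t₀ - c)) ∈ 𝓝 α₀ := by
        rw [← ht₀]
        exact Ioo_mem_nhds (hanti _ _ (by linarith)) (hanti _ _ (by linarith))
      filter_upwards [hnhds, hI.mem_nhds hα₀] with α hα hαI
      obtain ⟨t, ht, e⟩ := hF α hαI
      have h1 : t₀ - c < t := by
        by_contra! hc'
        rcases hc'.eq_or_lt with h' | h'
        · rw [← h', ht] at hα; exact lt_irrefl _ hα.2
        · have := hanti _ _ h'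
          rw [ht] at this
          exact lt_asymm this hα.2
      have h2 : t < t₀ + c := by
        by_contra! hc'
        rcases hc'.eq_or_lt with h' | h'
        · rw [h', ht] at hα; exact lt_irrefl _ hα.1
        · have := hanti _ _ h'
          rw [ht] at this
          exact lt_asymm this hα.1
      have u1 := hle α hαI t₀
      have u2 := hle α₀ hα₀ t
      have htc : |t - t₀| ≤ c := abs_le.2 ⟨by linarith, by linarith⟩
      -- Testing each infimum at the other's minimizer puts the increment of `F` between `(α - α₀) *
      -- t` and `(α - α₀) * t₀`.
      have key : |F α - F α₀ - (α - α₀) * t₀| ≤ |(t - t₀) * (α - α₀)| := by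
        rw [abs_le]
        have k1 := neg_abs_le ((t - t₀) * (α - α₀))
        constructor <;> nlinarith [abs_nonneg ((t - t₀) * (α - α₀))]
      rw [smul_eq_mul, Real.norm_eq_abs, Real.norm_eq_abs]
      refine key.trans ?_
      rw [abs_mul]
      gcongr
    exact hd.differentiableAt.differentiableWithinAt
  · refine ⟨hI', fun x hx y hy u v hu hv huv => ?_⟩
    have hz := hI' hx hy hu hv huv
    obtain ⟨t, -, e⟩ := hF _ hz
    have h1 := mul_le_mul_of_nonneg_left (hle x hx t) hu
    have h2 := mul_le_mul_of_nonneg_left (hle y hy t) hv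
    rw [e]
    simp only [smul_eq_mul]
    calc u * F x + v * F y ≤ u * (x * t + β t) + v * (y * t + β t) := add_le_add h1 h2
      _ = (u * x + v * y) * t + (u + v) * β t := by ring
      _ = _ := by rw [huv, one_mul]

section Tilt

variable {m n : ℕ} {D : Finset (Fin m × Fin n)} {p : Fin m × Fin n → ℝ}

/-- The weights of the Gibbs measure of parameter `t`. -/
noncomputable def tilt (D : Finset (Fin m × Fin n)) (p : Fin m × Fin n → ℝ) (t : ℝ)
    (d : Fin m × Fin n) : ℝ :=
  p d ^ t * q D p d.1 ^ ((1 - sigma m n) * t) * gamma D p t d.1 ^ (sigma m n - 1) /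
    pressureSum D p t

theorem gamma_pos (hp : ∀ d ∈ D, 0 < p d) (t : ℝ) {d : Fin m × Fin n} (hd : d ∈ D) :
    0 < gamma D p t d.1 :=
  Finset.sum_pos (fun e he => Real.rpow_pos_of_pos (hp e (Finset.mem_filter.1 he).1) _)
    ⟨d, by simp [hd]⟩

theorem q_row_pos (hp : ∀ d ∈ D, 0 < p d) {d : Fin m × Fin n} (hd : d ∈ D) : 0 < q D p d.1 :=
  q_pos hp ⟨d, hd⟩

theorem tilt_pos (hp : ∀ d ∈ D, 0 < p d) (t : ℝ) : ∀ d ∈ D, 0 < tilt D p t d := by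
  intro d hd
  have := pressureSum_pos ⟨d, hd⟩ hp t
  have := gamma_pos hp t hd
  have := q_row_pos hp hd
  have := hp d hd
  unfold tilt
  positivity

theorem sum_tilt (hD : D.Nonempty) (hp : ∀ d ∈ D, 0 < p d) (t : ℝ) :
    ∑ d ∈ D, tilt D p t d = 1 := by
  simp only [tilt]
  rw [← Finset.sum_div]
  exact div_self (pressureSum_pos hD hp t).ne'

/-- Summing a row contributes one factor γ, turning the exponent σ - 1 into σ. -/
theorem q_tilt (hp : ∀ d ∈ D, 0 < p d) (t : ℝ) {d : Fin m × Fin n} (hd : d ∈ D) :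
    q D (tilt D p t) d.1 = q D p d.1 ^ ((1 - sigma m n) * t) *
      gamma D p t d.1 ^ sigma m n / pressureSum D p t := by
  have h : ∀ e ∈ D.filter (fun e => e.1 = d.1), tilt D p t e =
      p e ^ t * (q D p d.1 ^ ((1 - sigma m n) * t) * gamma D p t d.1 ^ (sigma m n - 1) /
        pressureSum D p t) := by
    intro e he
    rw [tilt, (Finset.mem_filter.1 he).2]
    ring
  have hg := gamma_pos hp t hd
  rw [q, Finset.sum_congr rfl h, ← Finset.sum_mul]
  change gamma D p t d.1 * _ = _
  have e : gamma D p t d.1 ^ sigma m n =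
      gamma D p t d.1 ^ (sigma m n - 1) * gamma D p t d.1 := by
    rw [← Real.rpow_add_one hg.ne', sub_add_cancel]
  rw [e]
  ring

theorem log_pressureSum (hm : 1 < m) (t : ℝ) :
    Real.log (pressureSum D p t) = beta D p t * Real.log m := by
  have : 0 < Real.log m := Real.log_pos (by exact_mod_cast hm)
  rw [beta, Real.logb, div_mul_cancel₀ _ this.ne']

theorem log_tilt (hm : 1 < m) (hp : ∀ d ∈ D, 0 < p d) (t : ℝ) {d : Fin m × Fin n} (hd : d ∈ D) :
    Real.log (tilt D p t d) = t * Real.log (p d) + (1 - sigma m n) * t * Real.log (q D p d.1) +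
      (sigma m n - 1) * Real.log (gamma D p t d.1) - beta D p t * Real.log m := by
  have h1 := pressureSum_pos ⟨d, hd⟩ hp t
  have h2 := gamma_pos hp t hd
  have h3 := q_row_pos hp hd
  have h4 := hp d hd
  rw [tilt, Real.log_div (by positivity) h1.ne', Real.log_mul (by positivity) (by positivity),
    Real.log_mul (by positivity) (by positivity), Real.log_rpow h4, Real.log_rpow h3,
    Real.log_rpow h2, log_pressureSum hm]

theorem log_q_tilt (hm : 1 < m) (hp : ∀ d ∈ D, 0 < p d) (t : ℝ) {d : Fin m × Fin n}
    (hd : d ∈ D) :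
    Real.log (q D (tilt D p t) d.1) = (1 - sigma m n) * t * Real.log (q D p d.1) +
      sigma m n * Real.log (gamma D p t d.1) - beta D p t * Real.log m := by
  have h1 := pressureSum_pos ⟨d, hd⟩ hp t
  have h2 := gamma_pos hp t hd
  have h3 := q_row_pos hp hd
  rw [q_tilt hp t hd, Real.log_div (by positivity) h1.ne',
    Real.log_mul (by positivity) (by positivity), Real.log_rpow h3,
    Real.log_rpow h2, log_pressureSum hm]

theorem log_mul_digitExponent (hm : 1 < m) (d : Fin m × Fin n) :
    Real.log m * digitExponent D p d =
      -sigma m n * Real.log (p d) + (sigma m n - 1) * Real.log (q D p d.1) := by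
  have : 0 < Real.log m := Real.log_pos (by exact_mod_cast hm)
  rw [digitExponent, mul_div_cancel₀ _ this.ne']

/-- The γ terms cancel, with coefficients -σ(σ - 1) and (σ - 1)σ. This affine relation is the source
of the Legendre duality. -/
theorem digitExponent_tilt (hm : 1 < m) (hp : ∀ d ∈ D, 0 < p d) (t : ℝ)
    {d : Fin m × Fin n} (hd : d ∈ D) :
    digitExponent D (tilt D p t) d = beta D p t + t * digitExponent D p d := by
  have hm' : 0 < Real.log m := Real.log_pos (by exact_mod_cast hm)
  refine mul_left_cancel₀ hm'.ne' ?_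
  rw [mul_add, mul_left_comm, log_mul_digitExponent hm, log_mul_digitExponent hm,
    log_tilt hm hp t hd, log_q_tilt hm hp t hd]
  ring

/-- The ratio of marginals is constant on each row, so summing a row replaces the mass of `R` by
that of `P`. This is the normalization needed in Gibbs' inequality for the row marginals. -/
theorem sum_mul_q_div_q {P R : Fin m × Fin n → ℝ} (hR : ∀ d ∈ D, 0 < R d) :
    ∑ d ∈ D, R d * (q D P d.1 / q D R d.1) = ∑ d ∈ D, P d := by
  rw [← Finset.sum_fiberwise D (fun d => d.1), ← Finset.sum_fiberwise D (fun d => d.1) P]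
  refine Finset.sum_congr rfl fun i _ => ?_
  rcases (D.filter fun d => d.1 = i).eq_empty_or_nonempty with h | ⟨d, hd⟩
  · rw [h]; simp
  · have hq : 0 < q D R i := by
      have := q_row_pos hR (Finset.mem_filter.1 hd).1
      rwa [(Finset.mem_filter.1 hd).2] at this
    have e : ∀ e ∈ D.filter (fun e => e.1 = i), R e * (q D P e.1 / q D R e.1) =
        R e * (q D P i / q D R i) := fun e he => by rw [(Finset.mem_filter.1 he).2]
    rw [Finset.sum_congr rfl e, ← Finset.sum_mul]
    exact mul_div_cancel₀ _ hq.ne'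

/-- Gibbs' inequality for the weighted entropy of a measure and of its row marginal. -/
theorem gibbs_lt (hm : 1 < m) (hmn : m < n) {P R : Fin m × Fin n → ℝ} (hP : ∀ d ∈ D, 0 < P d)
    (hR : ∀ d ∈ D, 0 < R d) (hP1 : ∑ d ∈ D, P d = 1) (hR1 : ∑ d ∈ D, R d = 1)
    (hne : ∃ d ∈ D, P d ≠ R d) :
    ∑ d ∈ D, R d * digitExponent D R d < ∑ d ∈ D, R d * digitExponent D P d := by
  have hm' : 0 < Real.log m := Real.log_pos (by exact_mod_cast hm)
  have hσ := sigma_pos hm hmn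
  have hσ1 := sigma_lt_one hm hmn
  have hq : ∀ d ∈ D, R d * (Real.log (q D P d.1) - Real.log (q D R d.1)) ≤
      R d * (q D P d.1 / q D R d.1) - R d := by
    intro d hd
    have h1 := q_row_pos hP hd
    have h2 := q_row_pos hR hd
    have h := Real.log_le_sub_one_of_pos (div_pos h1 h2)
    rw [Real.log_div h1.ne' h2.ne'] at h
    nlinarith [hR d hd]
  have hle : ∀ d ∈ D, R d * (Real.log (P d) - Real.log (R d)) ≤ P d - R d := by
    intro d hd
    have h := Real.log_le_sub_one_of_pos (div_pos (hP d hd) (hR d hd))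
    rw [Real.log_div (hP d hd).ne' (hR d hd).ne'] at h
    have h' := mul_le_mul_of_nonneg_left h (hR d hd).le
    rwa [mul_sub_one, mul_div_cancel₀ _ (hR d hd).ne'] at h'
  have hlt : ∃ d ∈ D, R d * (Real.log (P d) - Real.log (R d)) < P d - R d := by
    obtain ⟨d, hd, h⟩ := hne
    refine ⟨d, hd, ?_⟩
    have h := Real.log_lt_sub_one_of_pos (div_pos (hP d hd) (hR d hd))
      (by rwa [Ne, div_eq_one_iff_eq (hR d hd).ne'])
    rw [Real.log_div (hP d hd).ne' (hR d hd).ne'] at h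
    have h' := mul_lt_mul_of_pos_left h (hR d hd)
    rwa [mul_sub_one, mul_div_cancel₀ _ (hR d hd).ne'] at h'
  have s1 := Finset.sum_lt_sum hle hlt
  have s2 := Finset.sum_le_sum hq
  rw [Finset.sum_sub_distrib, hP1, hR1, sub_self] at s1
  rw [Finset.sum_sub_distrib, sum_mul_q_div_q hR, hP1, hR1, sub_self] at s2
  -- The difference is minus σ times the relative entropy of `R` with respect to `P`, minus (1 - σ)
  -- times that of the row marginals. Strictness comes from the first.
  have e : Real.log m * (∑ d ∈ D, R d * digitExponent D R d -
      ∑ d ∈ D, R d * digitExponent D P d) =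
      sigma m n * ∑ d ∈ D, R d * (Real.log (P d) - Real.log (R d)) +
      (1 - sigma m n) * ∑ d ∈ D, R d * (Real.log (q D P d.1) - Real.log (q D R d.1)) := by
    rw [← Finset.sum_sub_distrib, Finset.mul_sum, Finset.mul_sum, Finset.mul_sum,
      ← Finset.sum_add_distrib]
    refine Finset.sum_congr rfl fun d _ => ?_
    rw [← mul_sub, mul_left_comm, mul_sub, log_mul_digitExponent hm, log_mul_digitExponent hm]
    ring
  have h3 : Real.log m * (∑ d ∈ D, R d * digitExponent D R d -
      ∑ d ∈ D, R d * digitExponent D P d) < 0 := by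
    rw [e]
    nlinarith
  have h4 := (pos_iff_neg_of_mul_neg h3).1 hm'
  linarith

/-- The mean of the digit exponent for the tilted weights. -/
noncomputable def meanExponent (D : Finset (Fin m × Fin n)) (p : Fin m × Fin n → ℝ) (t : ℝ) : ℝ :=
  ∑ d ∈ D, tilt D p t d * digitExponent D p d

theorem sum_tilt_mul_digitExponent_tilt (hm : 1 < m) (hD : D.Nonempty) (hp : ∀ d ∈ D, 0 < p d)
    (t s : ℝ) : ∑ d ∈ D, tilt D p t d * digitExponent D (tilt D p s) d =
      beta D p s + s * meanExponent D p t := by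
  rw [meanExponent, Finset.mul_sum]
  calc _ = ∑ d ∈ D, (tilt D p t d * beta D p s + s * (tilt D p t d * digitExponent D p d)) :=
        Finset.sum_congr rfl fun d hd => by
          rw [digitExponent_tilt hm hp s hd]; ring
    _ = _ := by rw [Finset.sum_add_distrib, ← Finset.sum_mul, sum_tilt hD hp, one_mul]

/-- Gibbs' inequality for the tilts at `s` and `t`. If these coincided, comparing their exponents at
two digits would force `s = t` or equal exponents for `p`. -/
theorem beta_add_lt (hm : 1 < m) (hmn : m < n) (hp : ∀ d ∈ D, 0 < p d)
    (hne : ∃ d ∈ D, ∃ d' ∈ D, digitExponent D p d ≠ digitExponent D p d') {t s : ℝ}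
    (hts : t ≠ s) : beta D p t + t * meanExponent D p t < beta D p s + s * meanExponent D p t := by
  obtain ⟨d₁, h₁, d₂, h₂, h₁₂⟩ := hne
  have hD : D.Nonempty := ⟨d₁, h₁⟩
  rw [← sum_tilt_mul_digitExponent_tilt hm hD hp, ← sum_tilt_mul_digitExponent_tilt hm hD hp]
  refine gibbs_lt hm hmn (tilt_pos hp s) (tilt_pos hp t) (sum_tilt hD hp s) (sum_tilt hD hp t) ?_
  by_contra! heq
  have hq : ∀ i, q D (tilt D p s) i = q D (tilt D p t) i := fun i =>
    Finset.sum_congr rfl fun d hd => heq d (Finset.mem_filter.1 hd).1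
  have he : ∀ d ∈ D, beta D p s + s * digitExponent D p d =
      beta D p t + t * digitExponent D p d := fun d hd => by
    rw [← digitExponent_tilt hm hp s hd, ← digitExponent_tilt hm hp t hd,
      digitExponent, digitExponent, heq d hd, hq]
  have e1 := he d₁ h₁
  have e2 := he d₂ h₂
  have : (s - t) * (digitExponent D p d₁ - digitExponent D p d₂) = 0 := by linarith
  rcases mul_eq_zero.1 this with h | h
  · exact hts (sub_eq_zero.1 h).symm
  · exact h₁₂ (sub_eq_zero.1 h)

theorem digitExponent_nonneg (hm : 1 < m) (hmn : m < n) (hp : ∀ d ∈ D, 0 < p d)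
    (hp1 : ∑ d ∈ D, p d = 1) {d : Fin m × Fin n} (hd : d ∈ D) : 0 ≤ digitExponent D p d := by
  have hm' : 0 < Real.log m := Real.log_pos (by exact_mod_cast hm)
  have hσ := sigma_pos hm hmn
  have hσ1 := sigma_lt_one hm hmn
  have h1 : p d ≤ 1 := hp1 ▸ Finset.single_le_sum (fun e he => (hp e he).le) hd
  have h2 : q D p d.1 ≤ 1 := hp1 ▸ Finset.sum_le_sum_of_subset_of_nonneg
    (Finset.filter_subset _ _) fun e he _ => (hp e he).le
  have h3 := Real.log_nonpos (hp d hd).le h1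
  have h4 := Real.log_nonpos (q_row_pos hp hd).le h2
  refine div_nonneg ?_ hm'.le
  nlinarith

theorem continuous_meanExponent (hp : ∀ d ∈ D, 0 < p d) : Continuous (meanExponent D p) := by
  have hpow : ∀ d ∈ D, Continuous fun t : ℝ => p d ^ t := fun d hd =>
    Real.continuous_const_rpow (hp d hd).ne'
  have hg : ∀ d ∈ D, Continuous fun t : ℝ => gamma D p t d.1 ^ (sigma m n - 1) := fun d hd =>
    (continuous_finsetSum _ fun e he => hpow e (Finset.mem_filter.1 he).1).rpow_const
      fun t => Or.inl (gamma_pos hp t hd).ne'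
  have hterm : ∀ d ∈ D, Continuous fun t : ℝ => p d ^ t * q D p d.1 ^ ((1 - sigma m n) * t) *
      gamma D p t d.1 ^ (sigma m n - 1) := fun d hd =>
    ((hpow d hd).mul ((Real.continuous_const_rpow (q_row_pos hp hd).ne').comp
      (continuous_const.mul continuous_id))).mul (hg d hd)
  refine continuous_finsetSum _ fun d hd => ((hterm d hd).div
    (continuous_finsetSum _ hterm) fun t => (pressureSum_pos ⟨d, hd⟩ hp t).ne').mul
      continuous_const

/-- Write e(d) for the digit exponent. Exponents of a probability vector are nonnegative, so β(t) +
t e(d) ≥ 0; minimality against s = 0 gives β(t) + tα(t) ≤ β(0). Hence t(α(t) - e(d)) ≤ β(0), which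
brings α(t) below α for a large positive t (d minimal) and above α for a large negative t (d
maximal). The intermediate value theorem concludes. -/
theorem exists_meanExponent_eq (hm : 1 < m) (hmn : m < n) (hp : ∀ d ∈ D, 0 < p d)
    (hD : D.Nonempty) {α : ℝ} (hα : α ∈ Ioo (alphaMin D p) (alphaMax D p)) :
    ∃ t, meanExponent D p t = α := by
  have : Nonempty D := hD.to_subtype
  obtain ⟨d₁, h₁⟩ := exists_eq_ciInf_of_finite (f := fun d : D => digitExponent D p d)
  obtain ⟨d₂, h₂⟩ := exists_eq_ciSup_of_finite (f := fun d : D => digitExponent D p d)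
  have e₁ : digitExponent D p d₁ < α := h₁.trans_lt hα.1
  have e₂ : α < digitExponent D p d₂ := hα.2.trans_eq h₂.symm
  have hb : ∀ (d : D) t, 0 ≤ beta D p t + t * digitExponent D p d := fun d t => by
    rw [← digitExponent_tilt hm hp t d.2]
    exact digitExponent_nonneg hm hmn (tilt_pos hp t) (sum_tilt hD hp t) d.2
  have hne : ∃ d ∈ D, ∃ d' ∈ D, digitExponent D p d ≠ digitExponent D p d' :=
    ⟨d₁, d₁.2, d₂, d₂.2, (e₁.trans e₂).ne⟩
  have h0 : ∀ t, beta D p t + t * meanExponent D p t ≤ beta D p 0 := fun t => by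
    rcases eq_or_ne t 0 with rfl | ht
    · simp
    · simpa using (beta_add_lt hm hmn hp hne ht).le
  have hβ : 0 ≤ beta D p 0 := by simpa using hb d₁ 0
  have hlow : ∃ t, meanExponent D p t ≤ α := by
    refine ⟨(beta D p 0 + 1) / (α - digitExponent D p d₁), ?_⟩
    have hpos : 0 < α - digitExponent D p d₁ := sub_pos.2 e₁
    set t := (beta D p 0 + 1) / (α - digitExponent D p d₁) with ht
    have ht0 : 0 < t := by positivity
    have e : t * (α - digitExponent D p d₁) = beta D p 0 + 1 := div_mul_cancel₀ _ hpos.ne'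
    have := h0 t
    have := hb d₁ t
    by_contra! hc
    nlinarith
  have hhigh : ∃ t, α ≤ meanExponent D p t := by
    refine ⟨-((beta D p 0 + 1) / (digitExponent D p d₂ - α)), ?_⟩
    have hpos : 0 < digitExponent D p d₂ - α := sub_pos.2 e₂
    set t := (beta D p 0 + 1) / (digitExponent D p d₂ - α) with ht
    have ht0 : 0 < t := by positivity
    have e : t * (digitExponent D p d₂ - α) = beta D p 0 + 1 := div_mul_cancel₀ _ hpos.ne'
    have := h0 (-t)
    have := hb d₂ (-t)
    by_contra! hc
    nlinarith
  obtain ⟨t₁, ht₁⟩ := hlow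
  obtain ⟨t₂, ht₂⟩ := hhigh
  exact mem_range_of_exists_le_of_exists_ge (continuous_meanExponent hp) ⟨t₁, ht₁⟩ ⟨t₂, ht₂⟩

end Tilt

/-! ### Averages along a sequence of neighbouring prefixes -/

/-- The average of `h` over the first `k` terms of `v`. -/
noncomputable def avg {ι : Type*} (h : ι → ℝ) (v : ℕ → ι) (k : ℕ) : ℝ :=
  (∑ s ∈ Finset.range k, h (v s)) / k

theorem avg_congr {ι : Type*} (h : ι → ℝ) {v v' : ℕ → ι} {k : ℕ} (hv : ∀ s < k, v s = v' s) :
    avg h v k = avg h v' k := by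
  rw [avg, avg, Finset.sum_congr rfl fun s hs => by rw [hv s (Finset.mem_range.1 hs)]]

theorem abs_avg_le {ι : Type*} {h : ι → ℝ} {H : ℝ} (hH : ∀ i, |h i| ≤ H) (v : ℕ → ι) (k : ℕ) :
    |avg h v k| ≤ H := by
  have hH0 : 0 ≤ H := (abs_nonneg _).trans (hH (v 0))
  rcases k.eq_zero_or_pos with rfl | hk
  · simpa [avg] using hH0
  · have hk' : (0 : ℝ) < k := by exact_mod_cast hk
    rw [avg, abs_div, Nat.abs_cast, div_le_iff₀ hk']
    refine (Finset.abs_sum_le_sum_abs _ _).trans ?_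
    refine (Finset.sum_le_sum fun s _ => hH (v s)).trans ?_
    rw [Finset.sum_const, Finset.card_range, nsmul_eq_mul, mul_comm]

theorem tendsto_avg_of_eventually_eq {ι : Type*} (h : ι → ℝ) {v : ℕ → ι} {c : ι}
    (hv : ∀ᶠ s in atTop, v s = c) : Tendsto (avg h v) atTop (𝓝 (h c)) := by
  have h1 : Tendsto (fun s => h (v s)) atTop (𝓝 (h c)) :=
    tendsto_const_nhds.congr' (hv.mono fun s hs => (congrArg h hs).symm)
  have h2 := h1.cesaro
  refine h2.congr fun k => ?_
  rw [avg, div_eq_inv_mul]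

theorem sum_range_of_const {ι : Type*} (h : ι → ℝ) (v : ℕ → ι) {a b : ℕ} (hab : a ≤ b) {c : ι}
    (hc : ∀ s, a ≤ s → s < b → v s = c) :
    ∑ s ∈ Finset.range b, h (v s) = ∑ s ∈ Finset.range a, h (v s) + ((b : ℝ) - a) * h c := by
  have e : ∑ s ∈ Finset.Ico a b, h (v s) = ∑ s ∈ Finset.Ico a b, h c :=
    Finset.sum_congr rfl fun s hs => by
      rw [hc s (Finset.mem_Ico.1 hs).1 (Finset.mem_Ico.1 hs).2]
  rw [← Finset.sum_range_add_sum_Ico _ hab, e, Finset.sum_const, Nat.card_Ico, nsmul_eq_mul,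
    Nat.cast_sub hab]

/-- If a sequence is constant on each stretch outside a set `A` of times that is unbounded, then
its averages are nearly minimal along `A`. -/
theorem exists_avg_le_of_const {ι : Type*} {h : ι → ℝ} {H : ℝ} (hH : ∀ i, |h i| ≤ H)
    (u : ℕ → ι) {A : ℕ → Prop} (hA : ∃ᶠ k in atTop, A k) (hu : ∀ k, ¬ A k → u (k + 1) = u k)
    {s₀ k : ℕ} (hs₀ : 0 < s₀) (hAs : A s₀) (hk : s₀ ≤ k) :
    ∃ e, s₀ ≤ e ∧ A e ∧ avg h u e ≤ avg h u k + 2 * H / s₀ := by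
  classical
  have hH0 : 0 ≤ H := (abs_nonneg _).trans (hH (u 0))
  have hs0 : (0 : ℝ) < s₀ := by exact_mod_cast hs₀
  have hk0 : (0 : ℝ) < k := by exact_mod_cast hs₀.trans_le hk
  have hpos : 0 ≤ 2 * H / s₀ := by positivity
  have hrun : ∀ a b, a ≤ b → (∀ j, a ≤ j → j < b → ¬ A j) → u b = u a := by
    intro a b hab hj
    induction b, hab using Nat.le_induction with
    | base => rfl
    | succ b hab ih =>
      rw [hu b (hj b hab (by omega)), ih fun j h1 h2 => hj j h1 (by omega)]
  -- On a constant stretch the average moves towards `h (u k)`. If this value is not above the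
  -- average, running on to the next time in `A` does not raise it; otherwise one goes back to the
  -- last time in `A`.
  rcases le_or_gt (h (u k)) (avg h u k) with hc | hc
  · have hex : ∃ e, k ≤ e ∧ A e := by
      obtain ⟨e, he, hAe⟩ := (frequently_atTop.1 hA) k
      exact ⟨e, he, hAe⟩
    obtain ⟨hke, hAe⟩ := Nat.find_spec hex
    set e := Nat.find hex with he
    refine ⟨e, hk.trans hke, hAe, ?_⟩
    have hS := sum_range_of_const h u hke (c := u k) fun s h1 h2 =>
      hrun k s h1 fun j h3 h4 hAj => Nat.find_min hex (h4.trans h2) ⟨h3, hAj⟩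
    have he0 : (0 : ℝ) < e := hk0.trans_le (by exact_mod_cast hke)
    have hke' : (k : ℝ) ≤ e := by exact_mod_cast hke
    have e1 : ∑ s ∈ Finset.range k, h (u s) = avg h u k * k := by
      rw [avg, div_mul_cancel₀ _ hk0.ne']
    have : avg h u e ≤ avg h u k := by
      rw [avg, div_le_iff₀ he0, hS, e1]
      nlinarith
    linarith
  · set s := Nat.findGreatest A k with hs
    have hAs' : A s := Nat.findGreatest_spec hk hAs
    have hsk : s ≤ k := Nat.findGreatest_le k
    have hss : s₀ ≤ s := Nat.le_findGreatest hk hAs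
    refine ⟨s, hss, hAs', ?_⟩
    rcases hsk.eq_or_lt with heq | hlt
    · rw [heq]; linarith
    have hnA : ∀ j, s + 1 ≤ j → j < k → ¬ A j := fun j h1 h2 =>
      Nat.findGreatest_is_greatest (by omega) h2.le
    -- The stretch starts only at `s + 1`; the uncontrolled digit at `s` costs the error `2 * H /
    -- s`.
    have hS := sum_range_of_const h u (a := s + 1) (b := k) hlt (c := u k) fun j h1 h2 =>
      (hrun j k h2.le fun i h3 h4 => hnA i (h1.trans h3) h4).symm
    rw [Finset.sum_range_succ] at hS
    have hs0' : (0 : ℝ) < s := by exact_mod_cast hs₀.trans_le hss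
    have hsk' : (s : ℝ) + 1 ≤ k := by exact_mod_cast hlt
    have hss' : (s₀ : ℝ) ≤ s := by exact_mod_cast hss
    have e1 : ∑ s ∈ Finset.range k, h (u s) = avg h u k * k := by
      rw [avg, div_mul_cancel₀ _ hk0.ne']
    have e2 : ∑ i ∈ Finset.range s, h (u i) = avg h u s * s := by
      rw [avg, div_mul_cancel₀ _ hs0'.ne']
    rw [e1, e2] at hS
    push_cast at hS
    have b1 := abs_le.1 (hH (u s))
    have b2 := abs_le.1 (abs_avg_le hH u k)
    have h2H : avg h u s * s ≤ avg h u k * s + 2 * H := by nlinarith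
    have h3 : avg h u s ≤ avg h u k + 2 * H / s := by
      rw [← sub_le_iff_le_add', le_div_iff₀ hs0']
      linarith
    have h4 : 2 * H / s ≤ 2 * H / s₀ := by gcongr
    linarith

/-- The prefix of `v` of length `k` is that of `u`, or one of its two neighbours and then `u` has
two extreme digits at `k`. -/
def IsNeighbour {m : ℕ} (u v : ℕ → Fin m) (k : ℕ) : Prop :=
  digitInt v k = digitInt u k ∨
    (digitInt v k = digitInt u k + 1 ∧ ∀ s < 2, (u (s + k) : ℕ) + 1 = m) ∨
    (digitInt v k + 1 = digitInt u k ∧ ∀ s < 2, (u (s + k) : ℕ) = 0)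

/-- If the prefixes are eventually proper neighbours, then they are prefixes of one sequence,
which is eventually constant. -/
theorem exists_limit_of_isNeighbour {m : ℕ} (hm : 1 < m) {u : ℕ → Fin m} {v : ℕ → ℕ → Fin m}
    (hv : ∀ k, IsNeighbour u (v k) k) (hne : ∀ᶠ k in atTop, digitInt (v k) k ≠ digitInt u k) :
    ∃ (v' : ℕ → Fin m) (c : Fin m), (∀ᶠ s in atTop, v' s = c) ∧
      ∀ᶠ k in atTop, ∀ s < k, v k s = v' s := by
  obtain ⟨K, hK⟩ := eventually_atTop.1 hne
  have hcase := fun k hk => (hv k).resolve_left (hK k hk)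
  have finish : ∀ c : Fin m, (∀ k, K ≤ k →
      digitInt (fun s => if s < K then v K s else c) k = digitInt (v k) k) →
      ∃ (v' : ℕ → Fin m) (c : Fin m), (∀ᶠ s in atTop, v' s = c) ∧
        ∀ᶠ k in atTop, ∀ s < k, v k s = v' s := by
    intro c hc
    refine ⟨fun s => if s < K then v K s else c, c, ?_, ?_⟩
    · filter_upwards [eventually_ge_atTop K] with s hs
      rw [if_neg (by omega)]
    · filter_upwards [eventually_ge_atTop K] with k hk
      exact (digitInt_eq_iff _ _ _).1 (hc k hk).symm
  have hbase : ∀ c : Fin m, digitInt (fun s => if s < K then v K s else c) K =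
      digitInt (v K) K := fun c => (digitInt_eq_iff _ _ _).2 fun s hs => if_pos hs
  rcases hcase K le_rfl with h0 | h0
  -- The side cannot switch: the extreme pairs at times k, k + 1 and k + 1, k + 2 share the digit at
  -- k + 1, which cannot be both `m - 1` and 0.
  · have hall : ∀ k, K ≤ k → digitInt (v k) k = digitInt u k + 1 ∧
        ∀ s < 2, (u (s + k) : ℕ) + 1 = m := by
      intro k hk
      induction k, hk using Nat.le_induction with
      | base => exact h0
      | succ k hk ih =>
        refine (hcase (k + 1) (by omega)).resolve_right fun h => ?_
        have h1 := ih.2 1 (by norm_num)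
        have h2 := h.2 0 (by norm_num)
        rw [zero_add] at h2
        rw [add_comm 1 k] at h1
        omega
    -- Adding one to a prefix ending in digits `m - 1` carries and leaves zeros.
    refine finish ⟨0, by omega⟩ fun k hk => ?_
    rw [(hall k hk).1]
    induction k, hk using Nat.le_induction with
    | base => rw [hbase, h0.1]
    | succ k hk ih =>
      have h1 := (hall k hk).2 0 (by norm_num)
      rw [zero_add] at h1
      rw [digitInt, ih, digitInt, if_neg (by omega), mul_add, mul_one, add_zero]
      omega
  · have hall : ∀ k, K ≤ k → digitInt (v k) k + 1 = digitInt u k ∧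
        ∀ s < 2, (u (s + k) : ℕ) = 0 := by
      intro k hk
      induction k, hk using Nat.le_induction with
      | base => exact h0
      | succ k hk ih =>
        refine (hcase (k + 1) (by omega)).resolve_left fun h => ?_
        have h1 := ih.2 1 (by norm_num)
        have h2 := h.2 0 (by norm_num)
        rw [zero_add] at h2
        rw [add_comm 1 k] at h1
        omega
    refine finish ⟨m - 1, by omega⟩ fun k hk => ?_
    rw [← add_left_inj 1, (hall k hk).1]
    induction k, hk using Nat.le_induction with
    | base => rw [hbase, h0.1]
    | succ k hk ih =>
      have h1 := (hall k hk).2 0 (by norm_num)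
      rw [zero_add] at h1
      rw [digitInt, digitInt, h1, ← ih, if_neg (by omega), mul_add, mul_one]
      simp only
      omega

/-- For one fixed sequence: if averages eventually exceeded those at `l k` by ε, then at times where
the average is close to its lower limit, the average at `l k` would be too far below that limit.
With neighbours, such times are sought among those where the prefix is that of `u`, by
`exists_avg_le_of_const`. If these times are bounded, the prefixes come from one eventually constant
sequence, whose averages converge. -/
theorem frequently_avg_le {m : ℕ} (hm : 1 < m) (h : Fin m → ℝ) {u : ℕ → Fin m}
    {v : ℕ → ℕ → Fin m} (hv : ∀ k, IsNeighbour u (v k) k) {l : ℕ → ℕ}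
    (hl : Tendsto l atTop atTop) (hlk : ∀ k, l k ≤ k) {ε : ℝ} (hε : 0 < ε) :
    ∃ᶠ k in atTop, avg h (v k) k ≤ avg h (v k) (l k) + ε := by
  by_contra hcon
  rw [not_frequently] at hcon
  simp only [not_le] at hcon
  obtain ⟨H, hH⟩ : ∃ H, ∀ i, |h i| ≤ H := by
    obtain ⟨H, hH⟩ := (Set.finite_range fun i => |h i|).bddAbove
    exact ⟨H, fun i => hH ⟨i, rfl⟩⟩
  by_cases hA : ∃ᶠ k in atTop, digitInt (v k) k = digitInt u k
  · have hu : ∀ k, digitInt (v k) k ≠ digitInt u k → u (k + 1) = u k := by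
      intro k hk
      rcases (hv k).resolve_left hk with h' | h'
      · have h1 := h'.2 0 (by norm_num)
        have h2 := h'.2 1 (by norm_num)
        rw [zero_add] at h1
        rw [add_comm 1 k] at h2
        exact Fin.ext (by omega)
      · have h1 := h'.2 0 (by norm_num)
        have h2 := h'.2 1 (by norm_num)
        rw [zero_add] at h1
        rw [add_comm 1 k] at h2
        exact Fin.ext (by omega)
    have hbd := fun k => abs_le.1 (abs_avg_le hH u k)
    have hb1 : IsBoundedUnder (· ≥ ·) atTop (avg h u) :=
      isBoundedUnder_of ⟨-H, fun k => (hbd k).1⟩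
    have hb2 : IsCoboundedUnder (· ≥ ·) atTop (avg h u) :=
      (isBoundedUnder_of ⟨H, fun k => (hbd k).2⟩ : IsBoundedUnder (· ≤ ·) atTop _).isCoboundedUnder_ge
    set lam := liminf (avg h u) atTop with hlam
    have hlow : ∀ᶠ k in atTop, lam - ε / 4 < avg h u k :=
      eventually_lt_of_lt_liminf (by linarith) hb1
    have hfreq : ∃ᶠ k in atTop, avg h u k < lam + ε / 4 :=
      frequently_lt_of_liminf_lt hb2 (by linarith)
    have hsmall : ∀ᶠ s : ℕ in atTop, 2 * H / (s : ℝ) < ε / 4 :=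
      (tendsto_const_div_atTop_nhds_zero_nat (2 * H)).eventually (gt_mem_nhds (by linarith))
    obtain ⟨K, hK⟩ := eventually_atTop.1
      (hcon.and ((hl.eventually hlow).and (hsmall.and (eventually_gt_atTop 0))))
    obtain ⟨s₀, hs₀, hAs⟩ := frequently_atTop.1 hA K
    obtain ⟨k, hk, hGk⟩ := frequently_atTop.1 hfreq s₀
    obtain ⟨e, he, hAe, hGe⟩ := exists_avg_le_of_const hH u hA hu (hK s₀ hs₀).2.2.2 hAs hk
    obtain ⟨h1, h2, -, -⟩ := hK e (hs₀.trans he)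
    have h3 := (hK s₀ hs₀).2.2.1
    have hpre := (digitInt_eq_iff _ _ _).1 hAe
    rw [avg_congr h hpre, avg_congr h fun s hs => hpre s (hs.trans_le (hlk e))] at h1
    linarith
  · rw [not_frequently] at hA
    obtain ⟨v', c, hc, hpre⟩ := exists_limit_of_isNeighbour hm hv hA
    have ht := tendsto_avg_of_eventually_eq h hc
    have h1 := (ht.sub (ht.comp hl)).eventually (gt_mem_nhds (by rwa [sub_self] :
      h c - h c < ε))
    obtain ⟨k, h2, h3, h4⟩ := (h1.and (hpre.and hcon)).exists
    rw [avg_congr h h3, avg_congr h fun s hs => h3 s (hs.trans_le (hlk k))] at h4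
    simp only [Function.comp] at h2
    linarith

/-! ### Upper bound for the dimension of the level sets -/

section Upper

variable {m n : ℕ} {D : Finset (Fin m × Fin n)} {p : Fin m × Fin n → ℝ}

/-- Beyond t · `logWeight p` and the β term, each digit before `level m n k` contributes (1 - σ)h
and each later one -σh. As `level m n k` ≈ σk, the sum compares two averages of `h`. -/
theorem logWeight_tilt (hm : 1 < m) (hmn : m < n) (hp : ∀ d ∈ D, 0 < p d) (t : ℝ) (w : ℕ → D)
    (k : ℕ) {h : Fin m → ℝ}
    (hh : ∀ i, h i = t * Real.log (q D p i) - Real.log (gamma D p t i)) :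
    logWeight (tilt D p t) w k = t * logWeight p w k - k * (beta D p t * Real.log m) +
      ∑ s ∈ Finset.range (level m n k), h (rowDigits w s) -
      sigma m n * ∑ s ∈ Finset.range k, h (rowDigits w s) := by
  have hl := level_le hm hmn k
  have e1 : ∑ s ∈ Finset.range (level m n k), h (rowDigits w s) =
      ∑ s ∈ Finset.range k, if s < level m n k then h (rowDigits w s) else 0 := by
    rw [← Finset.sum_filter]
    refine Finset.sum_congr ?_ fun _ _ => rfl
    ext s
    simp only [Finset.mem_range, Finset.mem_filter]
    omega
  have e2 : (k : ℝ) * (beta D p t * Real.log m) =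
      ∑ s ∈ Finset.range k, beta D p t * Real.log m := by simp
  rw [e1, e2, logWeight, logWeight, Finset.mul_sum, Finset.mul_sum, ← Finset.sum_sub_distrib,
    ← Finset.sum_add_distrib, ← Finset.sum_sub_distrib]
  refine Finset.sum_congr rfl fun s _ => ?_
  rw [hh]
  simp only [rowDigits]
  split_ifs
  · rw [log_tilt hm hp t (w s).2]
    ring
  · rw [log_q_tilt hm hp t (w s).2]
    ring

/-- The constant `H` pays for `level m n k` differing from σk by less than one. -/
theorem logWeight_tilt_ge (hm : 1 < m) (hmn : m < n) (hp : ∀ d ∈ D, 0 < p d) (t : ℝ)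
    {h : Fin m → ℝ} (hh : ∀ i, h i = t * Real.log (q D p i) - Real.log (gamma D p t i))
    {H : ℝ} (hH : ∀ i, |h i| ≤ H) {w : ℕ → D} {k : ℕ} {ε : ℝ} (hε : 0 ≤ ε)
    (hk : avg h (rowDigits w) k ≤ avg h (rowDigits w) (level m n k) + ε) :
    t * logWeight p w k - k * (beta D p t * Real.log m) - k * ε - H ≤
      logWeight (tilt D p t) w k := by
  have hσ := sigma_pos hm hmn
  have hσ1 := sigma_lt_one hm hmn
  have key : ∀ j, ∑ s ∈ Finset.range j, h (rowDigits w s) = avg h (rowDigits w) j * j := by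
    intro j
    rcases j.eq_zero_or_pos with rfl | hj
    · simp
    · rw [avg, div_mul_cancel₀]
      exact_mod_cast hj.ne'
  rw [logWeight_tilt hm hmn hp t w k hh, key, key]
  have h1 := level_le_sigma_mul hm hmn k
  have h2 := sigma_mul_lt_level hm hmn k
  have h3 := abs_le.1 (abs_avg_le hH (rowDigits w) (level m n k))
  have hH0 : 0 ≤ H := (abs_nonneg _).trans (hH (rowDigits w 0))
  set A := avg h (rowDigits w) k
  set B := avg h (rowDigits w) (level m n k)
  set L : ℝ := (level m n k : ℝ)
  have hk0 : (0 : ℝ) ≤ k := Nat.cast_nonneg k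
  have i1 : sigma m n * k * A ≤ sigma m n * k * (B + ε) :=
    mul_le_mul_of_nonneg_left hk (by positivity)
  have i2 : sigma m n * k * ε ≤ k * ε := by
    have : 0 ≤ k * ε := by positivity
    nlinarith
  have i3 : (sigma m n * k - L) * B ≤ H := by
    have a1 : 0 ≤ sigma m n * k - L := by linarith
    have a2 : sigma m n * k - L ≤ 1 := by linarith
    nlinarith
  nlinarith

theorem tendsto_log_measure_ball (hm : 1 < m) {μ : Measure (EuclideanSpace ℝ (Fin 2))}
    {x : EuclideanSpace ℝ (Fin 2)} {α : ℝ} (h : HasLocalDim μ x α) {C : ℝ} (hC : 0 < C) :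
    Tendsto (fun k : ℕ => Real.log (μ.real (Metric.closedBall x (C * ((m : ℝ)⁻¹) ^ k))) / k)
      atTop (𝓝 (-(α * Real.log m))) := by
  have hm' : (1 : ℝ) < m := by exact_mod_cast hm
  have hlm : 0 < Real.log m := Real.log_pos hm'
  have hr : Tendsto (fun k : ℕ => C * ((m : ℝ)⁻¹) ^ k) atTop (𝓝[>] 0) := by
    refine tendsto_nhdsWithin_iff.2 ⟨?_, Eventually.of_forall fun k => ?_⟩
    · simpa using (tendsto_pow_atTop_nhds_zero_of_lt_one (by positivity)
        (inv_lt_one_of_one_lt₀ hm')).const_mul C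
    · simp only [mem_Ioi]; positivity
  have hlog : ∀ k : ℕ, Real.log (C * ((m : ℝ)⁻¹) ^ k) = Real.log C - k * Real.log m := by
    intro k
    rw [Real.log_mul hC.ne' (by positivity), Real.log_pow, Real.log_inv]
    ring
  have h1 := h.comp hr
  have h2 : Tendsto (fun k : ℕ => (Real.log C - k * Real.log m) / k) atTop
      (𝓝 (0 - Real.log m)) := by
    refine ((tendsto_const_div_atTop_nhds_zero_nat (Real.log C)).sub
      tendsto_const_nhds).congr' ?_
    filter_upwards [eventually_gt_atTop 0] with k hk
    have : (k : ℝ) ≠ 0 := by exact_mod_cast hk.ne'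
    field_simp
  have h3 := h1.mul h2
  rw [zero_sub, mul_neg] at h3
  refine h3.congr' ?_
  have hne : ∀ᶠ k : ℕ in atTop, Real.log C < k * Real.log m :=
    (tendsto_natCast_atTop_atTop.atTop_mul_const hlm).eventually_gt_atTop _
  filter_upwards [hne] with k hk
  simp only [Function.comp]
  rw [hlog]
  exact div_mul_div_cancel₀ (by linarith)

theorem measureReal_map_code_closedBall (hm : 1 < m) (hn : 1 < n) (x : EuclideanSpace ℝ (Fin 2))
    (r : ℝ) : ((bernoulli D p).map (code D)).real (Metric.closedBall x r) =
      (bernoulli D p).real (code D ⁻¹' Metric.closedBall x r) :=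
  map_measureReal_apply (continuous_code hm hn D).measurable Metric.isClosed_closedBall.measurableSet

theorem exp_logWeight_le (hm : 1 < m) (hmn : m < n) (hp : ∀ d ∈ D, 0 < p d)
    [IsProbabilityMeasure (digitMeasure D p)] (w : ℕ → D) (k : ℕ) :
    Real.exp (logWeight p w k) ≤ ((bernoulli D p).map (code D)).real
      (Metric.closedBall (code D w) (2 * n ^ 2 * ((m : ℝ)⁻¹) ^ k)) := by
  rw [measureReal_map_code_closedBall hm (hm.trans hmn), ← bernoulli_real_square hm hmn hp]
  exact measureReal_mono fun w' hw' => dist_code_le_of_mem_square hm hmn hw'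

theorem measure_closedBall_code_pos (hm : 1 < m) (hmn : m < n) (hp : ∀ d ∈ D, 0 < p d)
    [IsProbabilityMeasure (digitMeasure D p)] (w : ℕ → D) {r : ℝ} (hr : 0 < r) :
    0 < ((bernoulli D p).map (code D)).real (Metric.closedBall (code D w) r) := by
  have hm' : (1 : ℝ) < m := by exact_mod_cast hm
  have hc : Measurable (code D) := (continuous_code hm (hm.trans hmn) D).measurable
  have := Measure.isProbabilityMeasure_map (μ := bernoulli D p) hc.aemeasurable
  have h1 : Tendsto (fun k : ℕ => 2 * (n : ℝ) ^ 2 * ((m : ℝ)⁻¹) ^ k) atTop (𝓝 0) := by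
    simpa using (tendsto_pow_atTop_nhds_zero_of_lt_one (by positivity)
      (inv_lt_one_of_one_lt₀ hm')).const_mul (2 * (n : ℝ) ^ 2)
  obtain ⟨k, hk⟩ := (h1.eventually (gt_mem_nhds hr)).exists
  exact (Real.exp_pos _).trans_le ((exp_logWeight_le hm hmn hp w k).trans
    (measureReal_mono (Metric.closedBall_subset_closedBall hk.le)))

/-- The sign of `t` decides which comparison with balls is needed. For `t < 0` an upper bound for
the mass of a square suffices, and the square of `w` lies in a ball. For `t ≥ 0` a lower bound is
needed, which holds only for some nearby square. -/
theorem exists_near_logWeight_ge (hm : 1 < m) (hmn : m < n) (hp : ∀ d ∈ D, 0 < p d)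
    [IsProbabilityMeasure (digitMeasure D p)] {w : ℕ → D} {α : ℝ}
    (hw : HasLocalDim ((bernoulli D p).map (code D)) (code D w) α) (t : ℝ) :
    ∃ v : ℕ → ℕ → D, (∀ k, dist (code D (v k)) (code D w) ≤ ((m : ℝ)⁻¹) ^ (k + 2)) ∧
      ∀ δ > 0, ∀ᶠ k : ℕ in atTop, -(k * (t * α * Real.log m + δ)) ≤ t * logWeight p (v k) k := by
  have hn : 0 < n := by omega
  rcases le_or_gt 0 t with ht | ht
  · choose v hv hv' using fun k => exists_square_near (p := p) hm hmn w k
    refine ⟨v, hv, fun δ hδ => ?_⟩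
    have h1 := tendsto_log_measure_ball hm hw (C := ((m : ℝ)⁻¹) ^ 2) (by positivity)
    have h2 := (h1.sub (tendsto_const_div_atTop_nhds_zero_nat (Real.log 9))).const_mul t
    have h3 := h2.eventually (lt_mem_nhds (a := -(t * α * Real.log m + δ))
      (by rw [sub_zero]; linarith))
    filter_upwards [h3, eventually_gt_atTop 0] with k hk hk0
    have hk0' : (0 : ℝ) < k := by exact_mod_cast hk0
    have hb := hv' k
    rw [← measureReal_map_code_closedBall hm (by omega), bernoulli_real_square hm hmn hp,
      pow_add, mul_comm (_ ^ k)] at hb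
    have hpos := measure_closedBall_code_pos hm hmn hp w
      (r := ((m : ℝ)⁻¹) ^ 2 * ((m : ℝ)⁻¹) ^ k) (by positivity)
    have hlog := Real.log_le_log hpos hb
    rw [Real.log_mul (by norm_num) (Real.exp_pos _).ne', Real.log_exp] at hlog
    rw [← sub_div, mul_div_assoc', lt_div_iff₀ hk0'] at hk
    have : t * (Real.log (((bernoulli D p).map (code D)).real
        (Metric.closedBall (code D w) (((m : ℝ)⁻¹) ^ 2 * ((m : ℝ)⁻¹) ^ k))) - Real.log 9) ≤
        t * logWeight p (v k) k := mul_le_mul_of_nonneg_left (by linarith) ht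
    linarith
  · refine ⟨fun _ => w, fun k => by rw [dist_self]; positivity, fun δ hδ => ?_⟩
    have h1 := tendsto_log_measure_ball hm hw (C := 2 * n ^ 2) (by positivity)
    have h3 := (h1.const_mul t).eventually (lt_mem_nhds (a := -(t * α * Real.log m + δ))
      (by linarith))
    filter_upwards [h3, eventually_gt_atTop 0] with k hk hk0
    have hk0' : (0 : ℝ) < k := by exact_mod_cast hk0
    have hlog := Real.log_le_log (Real.exp_pos _) (exp_logWeight_le hm hmn hp w k)
    rw [Real.log_exp] at hlog
    rw [mul_div_assoc', lt_div_iff₀ hk0'] at hk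
    have := mul_le_mul_of_nonpos_left hlog ht.le
    linarith

theorem isNeighbour_of_dist_le (hm : 1 < m) {w w' : ℕ → D} {k : ℕ}
    (h : dist (code D w') (code D w) ≤ ((m : ℝ)⁻¹) ^ (k + 2)) :
    IsNeighbour (rowDigits w) (rowDigits w') k := by
  refine digitInt_of_abs_sub_lt hm _ _ k 2 ?_
  rw [dist_comm] at h
  refine (mul_le_mul_of_nonneg_right ((abs_sub_le_dist _ _ 1).trans h)
    (by positivity)).trans_lt ?_
  rw [inv_pow, inv_mul_cancel₀ (by positivity)]
  exact_mod_cast hm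

theorem frequently_square_tilt_ge (hm : 1 < m) (hmn : m < n) (hp : ∀ d ∈ D, 0 < p d)
    [IsProbabilityMeasure (digitMeasure D p)] {w : ℕ → D} {α : ℝ}
    (hw : HasLocalDim ((bernoulli D p).map (code D)) (code D w) α) {t s : ℝ}
    (hs : α * t + beta D p t < s) :
    ∃ᶠ k : ℕ in atTop, ∃ w' : ℕ → D, dist (code D w') (code D w) ≤ ((m : ℝ)⁻¹) ^ (k + 2) ∧
      -(k * (s * Real.log m)) ≤ logWeight (tilt D p t) w' k := by
  have hlm : 0 < Real.log m := Real.log_pos (by exact_mod_cast hm)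
  obtain ⟨v, hv, hv'⟩ := exists_near_logWeight_ge hm hmn hp hw t
  set h : Fin m → ℝ := fun i => t * Real.log (q D p i) - Real.log (gamma D p t i)
  obtain ⟨H, hH⟩ : ∃ H, ∀ i, |h i| ≤ H := by
    obtain ⟨H, hH⟩ := (Set.finite_range fun i => |h i|).bddAbove
    exact ⟨H, fun i => hH ⟨i, rfl⟩⟩
  -- A third of the available room for each error: local dimension, comparison of averages, and the
  -- constant `H`.
  set δ := (s - (α * t + beta D p t)) * Real.log m / 3 with hδ
  have hδ0 : 0 < δ := by
    have : 0 < s - (α * t + beta D p t) := by linarith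
    positivity
  have h1 := frequently_avg_le hm h (fun k => isNeighbour_of_dist_le hm (hv k))
    (tendsto_level hm hmn) (level_le hm hmn) hδ0
  have h2 : ∀ᶠ k : ℕ in atTop, H < k * δ :=
    (tendsto_natCast_atTop_atTop.atTop_mul_const hδ0).eventually_gt_atTop _
  refine (h1.and_eventually ((hv' δ hδ0).and h2)).mono fun k hk => ⟨v k, hv k, ?_⟩
  obtain ⟨k1, k2, k3⟩ := hk
  have k4 := logWeight_tilt_ge hm hmn hp t (fun _ => rfl) hH hδ0.le k1
  have e : (k : ℝ) * (s * Real.log m) =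
      k * (t * α * Real.log m) + k * (beta D p t * Real.log m) + 3 * (k * δ) := by
    rw [hδ]; ring
  rw [e]
  linarith

/-- A nonempty piece `G k ab` has diameter of order m^(-k) and its cell has mass at least m^(-ks),
so its diameter to the power s' is at most a constant times m^(-k(s' - s)) times that mass. The
cells of one level are disjoint, so their masses sum to at most 1. The pieces of all levels k ≥ K
cover `E`, and the geometric tail tends to 0. -/
theorem dimH_le_of_frequently_square (hm : 1 < m) (hmn : m < n) {P : Fin m × Fin n → ℝ}
    (hP : ∀ d ∈ D, 0 < P d) [IsProbabilityMeasure (digitMeasure D P)]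
    {E : Set (EuclideanSpace ℝ (Fin 2))} {s s' : ℝ} (hs : s < s') (hs' : 0 < s')
    (hE : ∀ x ∈ E, ∃ᶠ k : ℕ in atTop, ∃ w' : ℕ → D, dist (code D w') x ≤ ((m : ℝ)⁻¹) ^ k ∧
      -(k * (s * Real.log m)) ≤ logWeight P w' k) : dimH E ≤ ENNReal.ofReal s' := by
  have hm' : (1 : ℝ) < m := by exact_mod_cast hm
  have hm0 : (0 : ℝ) < m := by linarith
  have hlm : 0 < Real.log m := Real.log_pos hm'
  have hn1 : (1 : ℝ) ≤ n := by exact_mod_cast (by omega : 1 ≤ n)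
  let S : ℕ → ℕ × ℕ → Set (ℕ → D) := fun k ab => {w' | digitInt (rowDigits w') k = ab.1 ∧
    digitInt (colDigits w') (level m n k) = ab.2}
  let G : ℕ → ℕ × ℕ → Set (EuclideanSpace ℝ (Fin 2)) := fun k ab =>
    {x | ∃ w' ∈ S k ab, dist (code D w') x ≤ ((m : ℝ)⁻¹) ^ k ∧
      -(k * (s * Real.log m)) ≤ logWeight P w' k}
  have hSq : ∀ k ab w', w' ∈ S k ab → S k ab = square w' k := by
    intro k ab w' hw'
    ext v
    rw [mem_square_iff, hw'.1, hw'.2]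
    rfl
  have hSmeas : ∀ k ab, MeasurableSet (S k ab) := by
    intro k ab
    rcases (S k ab).eq_empty_or_nonempty with h | ⟨w', hw'⟩
    · rw [h]; exact MeasurableSet.empty
    · rw [hSq k ab w' hw']
      have e : square w' k = (⋂ j ∈ Finset.range k, {v | rowDigits v j = rowDigits w' j}) ∩
          ⋂ j ∈ Finset.range (level m n k), {v | colDigits v j = colDigits w' j} := by
        ext v
        simp [square]
      rw [e]
      refine (Finset.measurableSet_biInter _ fun j _ => ?_).inter
        (Finset.measurableSet_biInter _ fun j _ => ?_)
      · exact measurableSet_preimage (f := fun v : ℕ → D => v j) (measurable_pi_apply j)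
          (Set.toFinite {d : D | d.1.1 = rowDigits w' j}).measurableSet
      · exact measurableSet_preimage (f := fun v : ℕ → D => v j) (measurable_pi_apply j)
          (Set.toFinite {d : D | d.1.2 = colDigits w' j}).measurableSet
  have hSsum : ∀ k, ∑' ab, bernoulli D P (S k ab) ≤ 1 := by
    intro k
    refine (tsum_meas_le_meas_iUnion_of_disjoint _ (hSmeas k) ?_).trans prob_le_one
    intro ab ab' hne
    refine Set.disjoint_left.2 fun w' h1 h2 => hne ?_
    exact Prod.ext (h1.1.symm.trans h2.1) (h1.2.symm.trans h2.2)
  have hdiam : ∀ k ab, Metric.ediam (G k ab) ≤ ENNReal.ofReal (4 * n ^ 2 * ((m : ℝ)⁻¹) ^ k) := by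
    intro k ab
    refine Metric.ediam_le fun x hx y hy => ?_
    obtain ⟨w', hw', hx', -⟩ := hx
    obtain ⟨w'', hw'', hy', -⟩ := hy
    rw [edist_dist]
    refine ENNReal.ofReal_le_ofReal ?_
    have h1 := dist_code_le_of_mem_square hm hmn (hSq k ab w'' hw'' ▸ hw')
    have h2 := dist_triangle4 x (code D w') (code D w'') y
    rw [dist_comm x (code D w')] at h2
    have hk : (0 : ℝ) < ((m : ℝ)⁻¹) ^ k := by positivity
    have : (1 : ℝ) ≤ n ^ 2 := one_le_pow₀ hn1
    nlinarith
  let c : ℕ → ℝ := fun k => (4 * n ^ 2) ^ s' * Real.exp (-((s' - s) * Real.log m)) ^ k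
  have hpow : ∀ k ab, Metric.ediam (G k ab) ^ s' ≤
      ENNReal.ofReal (c k) * bernoulli D P (S k ab) := by
    intro k ab
    rcases (G k ab).eq_empty_or_nonempty with h | ⟨x, w', hw', -, hx⟩
    · rw [h, Metric.ediam_empty, ENNReal.zero_rpow_of_pos hs']
      exact zero_le
    · refine (ENNReal.rpow_le_rpow (hdiam k ab) hs'.le).trans ?_
      rw [hSq k ab w' hw', bernoulli_square hm hmn hP,
        ENNReal.ofReal_rpow_of_nonneg (by positivity) hs'.le, ← ENNReal.ofReal_mul (by positivity)]
      refine ENNReal.ofReal_le_ofReal ?_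
      rw [Real.mul_rpow (by positivity) (by positivity), mul_assoc]
      refine mul_le_mul_of_nonneg_left ?_ (by positivity)
      rw [← Real.exp_nat_mul, ← Real.exp_add, inv_pow, ← Real.exp_log hm0, ← Real.exp_nat_mul,
        ← Real.exp_neg, ← Real.exp_mul, Real.exp_le_exp, Real.log_exp]
      linarith
  have hc : Summable c := by
    refine (summable_geometric_of_lt_one (Real.exp_pos _).le ?_).mul_left _
    rw [Real.exp_lt_one_iff, neg_lt_zero]
    exact mul_pos (by linarith) hlm
  have hcsum : ∑' k, ENNReal.ofReal (c k) ≠ ⊤ := by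
    rw [← ENNReal.ofReal_tsum_of_nonneg (fun k => by positivity) hc]
    exact ENNReal.ofReal_ne_top
  have htail := ENNReal.tendsto_sum_nat_add _ hcsum
  have hr : Tendsto (fun K : ℕ => ENNReal.ofReal (4 * n ^ 2 * ((m : ℝ)⁻¹) ^ K)) atTop (𝓝 0) := by
    rw [← ENNReal.ofReal_zero]
    refine ENNReal.tendsto_ofReal ?_
    simpa using (tendsto_pow_atTop_nhds_zero_of_lt_one (by positivity)
      (inv_lt_one_of_one_lt₀ hm')).const_mul (4 * (n : ℝ) ^ 2)
  have hH := Measure.hausdorffMeasure_le_liminf_tsum s' E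
    (fun K : ℕ => ENNReal.ofReal (4 * n ^ 2 * ((m : ℝ)⁻¹) ^ K)) hr
    (fun K (i : ℕ × (ℕ × ℕ)) => G (i.1 + K) i.2)
    (Eventually.of_forall fun K i => (hdiam _ _).trans (ENNReal.ofReal_le_ofReal (by
      gcongr 4 * (n : ℝ) ^ 2 * ?_
      exact pow_le_pow_of_le_one (by positivity) (inv_le_one_of_one_le₀ hm'.le) (by omega))))
    (Eventually.of_forall fun K x hx => by
      obtain ⟨k, hk, w', h1, h2⟩ := frequently_atTop.1 (hE x hx) K
      refine mem_iUnion.2 ⟨(k - K, digitInt (rowDigits w') k,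
        digitInt (colDigits w') (level m n k)), ?_⟩
      simp only [Nat.sub_add_cancel hk]
      exact ⟨w', ⟨rfl, rfl⟩, h1, h2⟩)
  have hzero : μH[s'] E = 0 := by
    refine le_antisymm (hH.trans ?_) zero_le
    rw [← htail.liminf_eq]
    refine liminf_le_liminf (Eventually.of_forall fun K => ?_)
    rw [ENNReal.tsum_prod']
    refine ENNReal.tsum_le_tsum fun j => ?_
    refine (ENNReal.tsum_le_tsum fun ab => hpow (j + K) ab).trans ?_
    rw [ENNReal.tsum_mul_left]
    exact mul_le_of_le_one_right' (hSsum _)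
  have := dimH_le_of_hausdorffMeasure_ne_top (s := E) (d := s'.toNNReal)
    (by rw [Real.coe_toNNReal _ hs'.le, hzero]; exact ENNReal.zero_ne_top)
  exact this

theorem isProbabilityMeasure_tilt (hD : D.Nonempty) (hp : ∀ d ∈ D, 0 < p d) (t : ℝ) :
    IsProbabilityMeasure (digitMeasure D (tilt D p t)) :=
  isProbabilityMeasure_digitMeasure (tilt_pos hp t) (sum_tilt hD hp t)

theorem dimH_levelSet_le (hm : 1 < m) (hmn : m < n) (hp : ∀ d ∈ D, 0 < p d) (hD : D.Nonempty)
    [IsProbabilityMeasure (digitMeasure D p)] (α t : ℝ) :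
    dimH (levelSet (range (code D)) ((bernoulli D p).map (code D)) α) ≤
      ENNReal.ofReal (α * t + beta D p t) := by
  have := isProbabilityMeasure_tilt hD hp t
  refine le_of_forall_gt fun c hc => ?_
  obtain ⟨r, hr, hrc⟩ := ENNReal.lt_iff_exists_nnreal_btwn.1 hc
  have hr0 : 0 < (r : ℝ) := by
    have := zero_le.trans_lt hr
    exact_mod_cast this
  have hr1 : α * t + beta D p t < r := by
    rw [← ENNReal.ofReal_coe_nnreal] at hr
    exact (ENNReal.ofReal_lt_ofReal_iff hr0).1 hr
  obtain ⟨s, hs, hsr⟩ := exists_between hr1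
  refine lt_of_le_of_lt ?_ hrc
  rw [← ENNReal.ofReal_coe_nnreal]
  refine dimH_le_of_frequently_square hm hmn (tilt_pos hp t) hsr hr0 ?_
  rintro _ ⟨⟨w, rfl⟩, hw⟩
  refine (frequently_square_tilt_ge hm hmn hp hw hs).mono ?_
  rintro k ⟨w', h1, h2⟩
  refine ⟨w', h1.trans (pow_le_pow_of_le_one (by positivity) ?_ (by omega)), h2⟩
  exact inv_le_one_of_one_le₀ (by exact_mod_cast hm.le)

end Upper

/-! ### Mass distribution principle -/

/-- `E` is split according to the scale below which the estimate holds; a piece of positive measure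
is then compared with Hausdorff measure. `E` need not be measurable. -/
theorem dimH_ge_of_measure_le_rpow {X : Type*} [MetricSpace X] [MeasurableSpace X] [BorelSpace X]
    (ν : Measure X) [IsFiniteMeasure ν] {E : Set X} (hE : ν E ≠ 0) {s : NNReal} (hs : 0 < s)
    (h : ∀ x ∈ E, ∀ᶠ r in 𝓝[>] (0 : ℝ), ν.real (Metric.closedBall x r) ≤ r ^ (s : ℝ)) :
    (s : ENNReal) ≤ dimH E := by
  let F : ℕ → Set X := fun N => {x ∈ E | ∀ r : ℝ, 0 < r → r < 1 / ((N : ℝ) + 1) →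
    ν.real (Metric.closedBall x r) ≤ r ^ (s : ℝ)}
  have hcov : E ⊆ ⋃ N, F N := by
    intro x hx
    obtain ⟨δ, hδ, hδ'⟩ := mem_nhdsGT_iff_exists_Ioo_subset.1 (h x hx)
    obtain ⟨N, hN⟩ := exists_nat_one_div_lt (mem_Ioi.1 hδ)
    exact mem_iUnion.2 ⟨N, hx, fun r h0 h1 => hδ' ⟨h0, h1.trans hN⟩⟩
  obtain ⟨N, hN⟩ : ∃ N, ν (F N) ≠ 0 := by
    by_contra! hzero
    exact hE (measure_mono_null hcov (measure_iUnion_null hzero))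
  have hs' : (0 : ℝ) < s := by exact_mod_cast hs
  set ρ : ℝ := 1 / ((N : ℝ) + 1) with hρ
  have hρ0 : 0 < ρ := by positivity
  have hle : ν.restrict (F N) ≤ μH[(s : ℝ)] := by
    refine Measure.le_hausdorffMeasure _ _ (ENNReal.ofReal (ρ / 2))
      (ENNReal.ofReal_pos.2 (by positivity)) fun S hS => ?_
    -- The closure is measurable and has the same diameter, so the restriction to the possibly
    -- non-measurable `F N` can be evaluated on it.
    refine (measure_mono (subset_closure (s := S))).trans ?_
    rw [Measure.restrict_apply isClosed_closure.measurableSet, ← Metric.ediam_closure S]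
    rw [← Metric.ediam_closure S] at hS
    set A := closure S with hA
    rcases (A ∩ F N).eq_empty_or_nonempty with he | ⟨x, hxA, hxF⟩
    · rw [he, measure_empty]; exact zero_le
    have hfin : Metric.ediam A ≠ ⊤ := ne_top_of_le_ne_top ENNReal.ofReal_ne_top hS
    have hδ : Metric.diam A ≤ ρ / 2 := ENNReal.toReal_le_of_le_ofReal (by positivity) hS
    have hδ0 : 0 ≤ Metric.diam A := Metric.diam_nonneg
    -- Radii slightly above the diameter also cover the case of diameter 0; they then decrease to
    -- the diameter.
    have hbound : ∀ r ∈ Ioo (Metric.diam A) ρ, ν.real (A ∩ F N) ≤ r ^ (s : ℝ) := by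
      rintro r ⟨h1, h2⟩
      refine le_trans (measureReal_mono fun y hy => ?_) (hxF.2 r (hδ0.trans_lt h1) h2)
      exact (Metric.dist_le_diam_of_mem' hfin hy.1 hxA).trans h1.le
    have hlim : Tendsto (fun r : ℝ => r ^ (s : ℝ)) (𝓝[>] (Metric.diam A))
        (𝓝 (Metric.diam A ^ (s : ℝ))) :=
      (Real.continuousAt_rpow_const _ _ (Or.inr hs'.le)).tendsto.mono_left nhdsWithin_le_nhds
    have hfinal : ν.real (A ∩ F N) ≤ Metric.diam A ^ (s : ℝ) := by
      refine ge_of_tendsto hlim ?_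
      filter_upwards [Ioo_mem_nhdsGT (by linarith : Metric.diam A < ρ)] with r hr
      exact hbound r hr
    rw [← ENNReal.ofReal_toReal (measure_ne_top ν (A ∩ F N)), ← ENNReal.ofReal_toReal hfin,
      ENNReal.ofReal_rpow_of_nonneg ENNReal.toReal_nonneg hs'.le]
    exact ENNReal.ofReal_le_ofReal hfinal
  have hpos : μH[(s : ℝ)] (F N) ≠ 0 := by
    refine fun h0 => hN ?_
    have := hle (F N)
    rw [Measure.restrict_apply_self, h0] at this
    exact le_antisymm this zero_le
  exact (le_dimH_of_hausdorffMeasure_ne_zero hpos).trans (dimH_mono fun x hx => hx.1)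

theorem dimH_ge_of_hasLocalDim (ν : Measure (EuclideanSpace ℝ (Fin 2))) [IsFiniteMeasure ν]
    {E : Set (EuclideanSpace ℝ (Fin 2))} (hE : ν E ≠ 0) {s : ℝ}
    (h : ∀ x ∈ E, HasLocalDim ν x s) : ENNReal.ofReal s ≤ dimH E := by
  refine le_of_forall_lt fun c hc => ?_
  obtain ⟨r, hcr, hr⟩ := ENNReal.lt_iff_exists_nnreal_btwn.1 hc
  have hr0 : 0 < r := by
    have := zero_le.trans_lt hcr
    exact_mod_cast this
  have hrs : (r : ℝ) < s := by
    rw [← ENNReal.ofReal_coe_nnreal] at hr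
    exact (ENNReal.ofReal_lt_ofReal_iff_of_nonneg r.2).1 hr
  refine hcr.trans_le (dimH_ge_of_measure_le_rpow ν hE hr0 fun x hx => ?_)
  filter_upwards [(h x hx).eventually (lt_mem_nhds hrs),
    Ioo_mem_nhdsGT (zero_lt_one' ℝ)] with ρ hρ hρ1
  rcases measureReal_nonneg.eq_or_lt' (a := ν.real (Metric.closedBall x ρ)) with h0 | h0
  · rw [h0]
    exact Real.rpow_nonneg hρ1.1.le _
  · have hlog := Real.log_neg hρ1.1 hρ1.2
    rw [lt_div_iff_of_neg hlog] at hρ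
    rw [← Real.log_le_log_iff h0 (Real.rpow_pos_of_pos hρ1.1 _), Real.log_rpow hρ1.1]
    exact hρ.le

/-! ### Typical points -/

section Typical

variable {m n : ℕ} {D : Finset (Fin m × Fin n)} {p P : Fin m × Fin n → ℝ}

/-- The averages along `w` of every function of the digits converge to its mean for the
weights `P`. -/
def IsTypical (P : Fin m × Fin n → ℝ) (w : ℕ → D) : Prop :=
  ∀ φ : D → ℝ, Tendsto (avg φ w) atTop (𝓝 (∑ d : D, P d * φ d))

/-- The strong law is applied to the indicators of the finitely many digits. Every `φ` is a linear
combination of these, so one null set serves all `φ`. -/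
theorem ae_isTypical (hP : ∀ d ∈ D, 0 < P d) [IsProbabilityMeasure (digitMeasure D P)] :
    ∀ᵐ w ∂bernoulli D P, IsTypical P w := by
  classical
  have hmap : ∀ i, (bernoulli D P).map (fun w => w i) = digitMeasure D P := fun i =>
    Measure.infinitePi_map_eval (fun _ : ℕ => digitMeasure D P) i
  have h1 : ∀ d : D, ∀ᵐ w ∂bernoulli D P,
      Tendsto (avg (fun e => if e = d then 1 else 0) w) atTop (𝓝 (P d)) := by
    intro d
    let g : D → ℝ := fun e => if e = d then 1 else 0
    have hg : Measurable g := measurable_of_finite g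
    have hev : ∀ i, Measurable fun w : ℕ → D => g (w i) := fun i =>
      hg.comp (measurable_pi_apply i)
    have hmean : ∫ w, g (w 0) ∂bernoulli D P = P d := by
      have e : (fun w : ℕ → D => g (w 0)) = indicator {w | w 0 = d} 1 := by
        funext w
        simp [g, indicator_apply]
      have hmeas : MeasurableSet {w : ℕ → D | w 0 = d} :=
        measurableSet_preimage (f := fun w : ℕ → D => w 0) (measurable_pi_apply 0)
          (measurableSet_singleton d)
      rw [e, integral_indicator_one hmeas, measureReal_def]
      have e2 : bernoulli D P {w | w 0 = d} = digitMeasure D P {d} := by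
        rw [← hmap 0, Measure.map_apply (measurable_pi_apply 0) (measurableSet_singleton d)]
        rfl
      rw [e2, digitMeasure_singleton, ENNReal.toReal_ofReal (hP d d.2).le]
    have h := ProbabilityTheory.strong_law_ae_real (μ := bernoulli D P)
      (fun i (w : ℕ → D) => g (w i))
      (Integrable.of_bound (hev 0).aestronglyMeasurable 1 (Eventually.of_forall fun w => by
        simp only [g]; split_ifs <;> simp))
      (fun i j hij => (ProbabilityTheory.iIndepFun_infinitePi (P := fun _ : ℕ => digitMeasure D P)
        (X := fun _ => g) fun _ => hg).indepFun hij)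
      (fun i => ⟨(hev i).aemeasurable, (hev 0).aemeasurable, by
        have e : ∀ i, (bernoulli D P).map (fun w => g (w i)) = (digitMeasure D P).map g := by
          intro i
          rw [← hmap i, Measure.map_map hg (measurable_pi_apply i)]
          rfl
        rw [e i, e 0]⟩)
    rw [hmean] at h
    exact h
  filter_upwards [ae_all_iff.2 h1] with w hw φ
  have h2 : Tendsto (fun k => ∑ d : D, avg (fun e => if e = d then 1 else 0) w k * φ d) atTop
      (𝓝 (∑ d : D, P d * φ d)) := tendsto_finsetSum _ fun d _ => (hw d).mul_const _
  refine h2.congr fun k => ?_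
  simp only [avg, div_mul_eq_mul_div, ← Finset.sum_div, Finset.sum_mul]
  rw [Finset.sum_comm]
  simp

theorem IsTypical.tendsto_sum_level (hm : 1 < m) (hmn : m < n) {w : ℕ → D} (hw : IsTypical P w)
    (φ : D → ℝ) : Tendsto (fun k : ℕ => (∑ s ∈ Finset.range (level m n k), φ (w s)) / k) atTop
      (𝓝 (sigma m n * ∑ d : D, P d * φ d)) := by
  have h := (tendsto_level_div hm hmn).mul ((hw φ).comp (tendsto_level hm hmn))
  refine h.congr' ?_
  filter_upwards [(tendsto_level hm hmn).eventually_gt_atTop 0] with k hk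
  have hk' : (level m n k : ℝ) ≠ 0 := by exact_mod_cast hk.ne'
  simp only [Function.comp, avg]
  field_simp

theorem logWeight_eq (hm : 1 < m) (hmn : m < n) (w : ℕ → D) (k : ℕ) :
    logWeight p w k = ∑ s ∈ Finset.range (level m n k), Real.log (p (w s)) +
      (∑ s ∈ Finset.range k, Real.log (q D p (w s).1.1) -
        ∑ s ∈ Finset.range (level m n k), Real.log (q D p (w s).1.1)) := by
  have hl := level_le hm hmn k
  have e : ∀ f : D → ℝ, ∑ s ∈ Finset.range (level m n k), f (w s) =
      ∑ s ∈ Finset.range k, if s < level m n k then f (w s) else 0 := by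
    intro f
    rw [← Finset.sum_filter]
    refine Finset.sum_congr ?_ fun _ _ => rfl
    ext s
    simp only [Finset.mem_range, Finset.mem_filter]
    omega
  rw [e fun d => Real.log (p d), e fun d => Real.log (q D p d.1.1), logWeight,
    ← Finset.sum_sub_distrib, ← Finset.sum_add_distrib]
  refine Finset.sum_congr rfl fun s _ => ?_
  split_ifs <;> ring

theorem IsTypical.tendsto_logWeight (hm : 1 < m) (hmn : m < n) {w : ℕ → D} (hw : IsTypical P w) :
    Tendsto (fun k : ℕ => -(logWeight p w k / k) / Real.log m) atTop
      (𝓝 (∑ d ∈ D, P d * digitExponent D p d)) := by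
  have hlm : 0 < Real.log m := Real.log_pos (by exact_mod_cast hm)
  have h1 := hw.tendsto_sum_level hm hmn fun d => Real.log (p d)
  have h2 := hw.tendsto_sum_level hm hmn fun d => Real.log (q D p d.1.1)
  have h3 := hw fun d => Real.log (q D p d.1.1)
  have h := ((h1.add (h3.sub h2)).neg).div_const (Real.log m)
  have e : -(sigma m n * ∑ d : D, P d * Real.log (p d) +
      (∑ d : D, P d * Real.log (q D p d.1.1) -
        sigma m n * ∑ d : D, P d * Real.log (q D p d.1.1))) / Real.log m =
      ∑ d ∈ D, P d * digitExponent D p d := by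
    rw [← Finset.sum_coe_sort D, Finset.mul_sum, Finset.mul_sum, ← Finset.sum_sub_distrib,
      ← Finset.sum_add_distrib, ← Finset.sum_neg_distrib, Finset.sum_div]
    refine Finset.sum_congr rfl fun d _ => ?_
    rw [digitExponent]
    ring
  rw [e] at h
  refine h.congr fun k => ?_
  rw [logWeight_eq hm hmn, avg, add_div, sub_div]

/-- A digit property of positive frequency occurs in every relatively long stretch. -/
theorem IsTypical.eventually_exists_ne_zero {w : ℕ → D} (hw : IsTypical P w) {φ : D → ℝ}
    (hφ : 0 < ∑ d : D, P d * φ d) {ε : ℝ} (hε : 0 < ε) :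
    ∀ᶠ a : ℕ in atTop, ∀ b : ℕ, (1 + ε) * a ≤ b → ∃ s, a ≤ s ∧ s < b ∧ φ (w s) ≠ 0 := by
  set ρ := ∑ d : D, P d * φ d with hρ
  -- With this value (ρ - η)(1 + ε) > ρ + η. Equal sums at `a` and `b ≥ (1 + ε) * a` then cannot
  -- both have averages within η of ρ.
  set η := ρ * ε / (2 * (2 + ε)) with hη
  have hη0 : 0 < η := by positivity
  have hηe : η * (2 + ε) = ρ * ε / 2 := by rw [hη]; field_simp
  have h1 := (hw φ).eventually (Ioo_mem_nhds (by linarith : ρ - η < ρ) (by linarith : ρ < ρ + η))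
  obtain ⟨K, hK⟩ := eventually_atTop.1 h1
  filter_upwards [eventually_ge_atTop K, eventually_gt_atTop 0] with a ha ha0 b hb
  by_contra! hcon
  have ha0' : (0 : ℝ) < a := by exact_mod_cast ha0
  have hab' : (a : ℝ) < b := by nlinarith
  have hab : a ≤ b := by exact_mod_cast hab'.le
  have hS : ∑ s ∈ Finset.range b, φ (w s) = ∑ s ∈ Finset.range a, φ (w s) := by
    rw [← Finset.sum_range_add_sum_Ico _ hab, Finset.sum_eq_zero (s := Finset.Ico a b), add_zero]
    exact fun s hs => hcon s (Finset.mem_Ico.1 hs).1 (Finset.mem_Ico.1 hs).2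
  have h2 := (hK a ha).2
  have h3 := (hK b (ha.trans hab)).1
  rw [avg, div_lt_iff₀ ha0'] at h2
  rw [avg, lt_div_iff₀ (ha0'.trans hab'), hS] at h3
  have hpos : 0 < ρ - η := by
    have : η * (2 + ε) < ρ * (2 + ε) := by rw [hηe]; nlinarith
    linarith [lt_of_mul_lt_mul_right this (by positivity)]
  have h4 : (ρ - η) * ((1 + ε) * a) ≤ (ρ - η) * b := mul_le_mul_of_nonneg_left hb hpos.le
  have h5 : (ρ - η) * (1 + ε) * a < (ρ + η) * a := by linarith
  have h6 := lt_of_mul_lt_mul_right h5 ha0'.le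
  nlinarith

theorem IsTypical.eventually_not_const {w : ℕ → D} (hw : IsTypical P w) (hP : ∀ d ∈ D, 0 < P d)
    {ι : Type*} {g : D → ι} (hg : ∃ d d', g d ≠ g d') (c : ι) {ε : ℝ} (hε : 0 < ε) :
    ∀ᶠ a : ℕ in atTop, ∀ j : ℕ, ε * a ≤ j → ∃ s < j, g (w (s + a)) ≠ c := by
  classical
  have hex : ∃ d, g d ≠ c := by
    obtain ⟨d, d', h⟩ := hg
    by_contra! hall
    exact h ((hall d).trans (hall d').symm)
  obtain ⟨d, hd⟩ := hex
  let φ : D → ℝ := fun e => if g e = c then 0 else 1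
  have hφ : 0 < ∑ d : D, P d * φ d := by
    refine Finset.sum_pos' (fun e _ => mul_nonneg (hP e e.2).le ?_) ⟨d, Finset.mem_univ d, ?_⟩
    · simp only [φ]; split_ifs <;> norm_num
    · simp only [φ, if_neg hd, mul_one]
      exact hP d d.2
  filter_upwards [hw.eventually_exists_ne_zero hφ hε] with a ha j hj
  obtain ⟨s, h1, h2, h3⟩ := ha (a + j) (by push_cast; linarith)
  refine ⟨s - a, by omega, fun he => h3 ?_⟩
  rw [Nat.sub_add_cancel h1] at he
  simp only [φ, if_pos he]

/-- If the ball reached another square, `w` would have `j` extreme row digits from time `k`, or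
`level m n j` extreme column digits from time `level m n k`. Both runs are too long for a typical
sequence. -/
theorem IsTypical.eventually_preimage_ball_subset (hm : 1 < m) (hmn : m < n) {w : ℕ → D}
    (hw : IsTypical P w) (hP : ∀ d ∈ D, 0 < P d)
    (hrow : ∃ d ∈ D, ∃ d' ∈ D, d.1 ≠ d'.1) (hcol : ∃ d ∈ D, ∃ d' ∈ D, d.2 ≠ d'.2)
    {ε : ℝ} (hε : 0 < ε) : ∀ᶠ k : ℕ in atTop, ∀ j : ℕ, ε * k ≤ j →
      code D ⁻¹' Metric.closedBall (code D w) (((m : ℝ)⁻¹) ^ (k + j)) ⊆ square w k := by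
  have hn := hm.trans hmn
  have hσ := sigma_pos hm hmn
  obtain ⟨d₁, h₁, d₂, h₂, h₁₂⟩ := hrow
  obtain ⟨d₃, h₃, d₄, h₄, h₃₄⟩ := hcol
  have hr : ∃ d d' : D, d.1.1 ≠ d'.1.1 := ⟨⟨d₁, h₁⟩, ⟨d₂, h₂⟩, h₁₂⟩
  have hc : ∃ d d' : D, d.1.2 ≠ d'.1.2 := ⟨⟨d₃, h₃⟩, ⟨d₄, h₄⟩, h₃₄⟩
  have hL := tendsto_level hm hmn
  have hbig : ∀ᶠ k : ℕ in atTop, 1 ≤ sigma m n * ε / 2 * k :=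
    (tendsto_natCast_atTop_atTop.const_mul_atTop (by positivity)).eventually_ge_atTop _
  filter_upwards [hw.eventually_not_const hP hr ⟨0, by omega⟩ hε,
    hw.eventually_not_const hP hr ⟨m - 1, by omega⟩ hε,
    hL.eventually (hw.eventually_not_const hP hc ⟨0, by omega⟩ (half_pos hε)),
    hL.eventually (hw.eventually_not_const hP hc ⟨n - 1, by omega⟩ (half_pos hε)), hbig]
    with k hk1 hk2 hk3 hk4 hk5 j hj w' hw'
  have hd : dist (code D w) (code D w') ≤ ((m : ℝ)⁻¹) ^ (k + j) := by
    rw [dist_comm]; exact hw'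
  have hinv : ((m : ℝ)⁻¹) ^ (k + j) * (m : ℝ) ^ (k + j) = 1 := by
    rw [inv_pow, inv_mul_cancel₀ (by positivity)]
  -- Passing from ε to ε / 2 absorbs the loss of one in the integer part `level m n j`.
  have hj' : ε / 2 * level m n k ≤ level m n j := by
    have a1 := level_le_sigma_mul hm hmn k
    have a2 := sigma_mul_lt_level hm hmn j
    have a3 : sigma m n * (ε * k) ≤ sigma m n * j := mul_le_mul_of_nonneg_left hj hσ.le
    have a4 : ε / 2 * level m n k ≤ ε / 2 * (sigma m n * k) :=
      mul_le_mul_of_nonneg_left a1 (by positivity)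
    nlinarith
  rw [mem_square_iff]
  constructor
  · have h := digitInt_of_abs_sub_lt hm (rowDigits w) (rowDigits w') k j (by
      refine (mul_le_mul_of_nonneg_right ((abs_sub_le_dist _ _ 1).trans hd)
        (by positivity)).trans_lt ?_
      rw [hinv]
      exact_mod_cast hm)
    rcases h with h | ⟨-, h⟩ | ⟨-, h⟩
    · exact h
    · obtain ⟨s, hs, hne⟩ := hk2 j hj
      refine absurd (Fin.ext ?_) hne
      have := h s hs
      simp only [rowDigits] at this
      simp only
      omega
    · obtain ⟨s, hs, hne⟩ := hk1 j hj
      exact absurd (Fin.ext (h s hs)) hne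
  · have h := digitInt_of_abs_sub_lt hn (colDigits w) (colDigits w') (level m n k) (level m n j) (by
      refine (mul_le_mul_of_nonneg_right ((abs_sub_le_dist _ _ 0).trans hd)
        (by positivity)).trans_lt ?_
      have hl : (n : ℝ) ^ (level m n k + level m n j) ≤ (m : ℝ) ^ (k + j) := by
        rw [pow_add, pow_add]
        exact_mod_cast Nat.mul_le_mul (pow_level_le hm k) (pow_level_le hm j)
      refine (mul_le_mul_of_nonneg_left hl (by positivity)).trans_lt ?_
      rw [hinv]
      exact_mod_cast hn)
    rcases h with h | ⟨-, h⟩ | ⟨-, h⟩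
    · exact h
    · obtain ⟨s, hs, hne⟩ := hk4 _ hj'
      refine absurd (Fin.ext ?_) hne
      have := h s hs
      simp only [colDigits] at this
      simp only
      omega
    · obtain ⟨s, hs, hne⟩ := hk3 _ hj'
      exact absurd (Fin.ext (h s hs)) hne

theorem IsTypical.hasLocalDim (hm : 1 < m) (hmn : m < n) (hp : ∀ d ∈ D, 0 < p d)
    [IsProbabilityMeasure (digitMeasure D p)] {w : ℕ → D}
    (hw : IsTypical P w) (hP : ∀ d ∈ D, 0 < P d)
    (hrow : ∃ d ∈ D, ∃ d' ∈ D, d.1 ≠ d'.1) (hcol : ∃ d ∈ D, ∃ d' ∈ D, d.2 ≠ d'.2) :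
    HasLocalDim ((bernoulli D p).map (code D)) (code D w)
      (∑ d ∈ D, P d * digitExponent D p d) := by
  have hm' : (1 : ℝ) < m := by exact_mod_cast hm
  have hm0 : (0 : ℝ) < m := by linarith
  have hlm : 0 < Real.log m := Real.log_pos hm'
  have hn := hm.trans hmn
  have hn0 : (0 : ℝ) < n := by exact_mod_cast (by omega : 0 < n)
  have hc : Measurable (code D) := (continuous_code hm hn D).measurable
  have := Measure.isProbabilityMeasure_map (μ := bernoulli D p) hc.aemeasurable
  set α := ∑ d ∈ D, P d * digitExponent D p d with hα
  set μ := (bernoulli D p).map (code D) with hμ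
  have hlim := hw.tendsto_logWeight (p := p) hm hmn
  rw [← hα] at hlim
  have hu : Tendsto (fun r : ℝ => -Real.log r / Real.log m) (𝓝[>] 0) atTop :=
    (tendsto_neg_atBot_atTop.comp Real.tendsto_log_nhdsGT_zero).atTop_div_const hlm
  have hcomp : ∀ (f : ℝ → ℕ) (c : ℝ), Tendsto f atTop atTop →
      Tendsto (fun u => (f u : ℝ) / u) atTop (𝓝 c) →
      Tendsto (fun u : ℝ => -logWeight p w (f u) / (u * Real.log m)) atTop (𝓝 (α * c)) := by
    intro f c hf hfc
    refine ((hlim.comp hf).mul hfc).congr' ?_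
    filter_upwards [hf.eventually_gt_atTop 0] with u hfu
    have : (f u : ℝ) ≠ 0 := by exact_mod_cast hfu.ne'
    simp only [Function.comp]
    field_simp
  have hpow : ∀ (r : ℝ) (j : ℕ), 0 < r → (j : ℝ) ≤ -Real.log r / Real.log m →
      r ≤ ((m : ℝ)⁻¹) ^ j := by
    intro r j hr hj
    rw [le_div_iff₀ hlm] at hj
    rw [← Real.log_le_log_iff hr (by positivity), Real.log_pow, Real.log_inv]
    linarith
  have hupper : ∀ b > α, ∀ᶠ r in 𝓝[>] (0 : ℝ),
      Real.log (μ.real (Metric.closedBall (code D w) r)) / Real.log r < b := by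
    intro b hb
    -- Write r = m^(-u). A square of level k lies within m^(-(k - c)) of its centre, so level ⌈u +
    -- c⌉ fits into the ball of radius r.
    set c := Real.log (2 * n ^ 2) / Real.log m with hcdef
    have hf : Tendsto (fun u : ℝ => ⌈u + c⌉₊) atTop atTop :=
      tendsto_nat_ceil_atTop.comp (tendsto_atTop_add_const_right _ c tendsto_id)
    have hfc : Tendsto (fun u : ℝ => (⌈u + c⌉₊ : ℝ) / u) atTop (𝓝 1) := by
      have h1 := (tendsto_nat_ceil_div_atTop (R := ℝ)).comp
        (tendsto_atTop_add_const_right atTop c tendsto_id)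
      have h2 : Tendsto (fun u : ℝ => (u + c) / u) atTop (𝓝 1) := by
        have h3 : Tendsto (fun u : ℝ => 1 + c / u) atTop (𝓝 (1 + 0)) :=
          tendsto_const_nhds.add (tendsto_const_nhds.div_atTop tendsto_id)
        rw [add_zero] at h3
        refine h3.congr' ?_
        filter_upwards [eventually_gt_atTop 0] with u hu
        field_simp
      have h4 := h1.mul h2
      rw [one_mul] at h4
      refine h4.congr' ?_
      filter_upwards [eventually_gt_atTop (-c)] with u hu
      simp only [Function.comp, id]
      exact div_mul_div_cancel₀ (by linarith)
    have h := (hcomp _ 1 hf hfc).eventually (gt_mem_nhds (by rwa [mul_one] : α * 1 < b))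
    filter_upwards [hu.eventually h, Ioo_mem_nhdsGT (zero_lt_one' ℝ)] with r hr hr1
    have hlr := Real.log_neg hr1.1 hr1.2
    set u := -Real.log r / Real.log m with hudef
    have hue : u * Real.log m = -Real.log r := div_mul_cancel₀ _ hlm.ne'
    rw [hue, neg_div_neg_eq] at hr
    refine lt_of_le_of_lt ?_ hr
    refine div_le_div_of_nonpos_of_le hlr.le ?_
    rw [← Real.log_exp (logWeight p w _)]
    refine Real.log_le_log (Real.exp_pos _) ((exp_logWeight_le hm hmn hp w _).trans
      (measureReal_mono (Metric.closedBall_subset_closedBall ?_)))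
    have hce := Nat.le_ceil (u + c)
    have h2n : (0 : ℝ) < 2 * n ^ 2 := by positivity
    rw [← Real.log_le_log_iff (by positivity) hr1.1, Real.log_mul h2n.ne' (by positivity),
      Real.log_pow, Real.log_inv]
    have e1 : c * Real.log m = Real.log (2 * n ^ 2) := div_mul_cancel₀ _ hlm.ne'
    have := mul_le_mul_of_nonneg_right hce hlm.le
    rw [add_mul, hue, e1] at this
    linarith
  have hlower : ∀ a < α, ∀ᶠ r in 𝓝[>] (0 : ℝ),
      a < Real.log (μ.real (Metric.closedBall (code D w) r)) / Real.log r := by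
    intro a ha
    obtain ⟨ε, hε, hεa⟩ : ∃ ε > 0, a < α * (1 + ε)⁻¹ := by
      have h : Tendsto (fun ε : ℝ => α * (1 + ε)⁻¹) (𝓝[>] 0) (𝓝 α) := by
        have hcont : ContinuousAt (fun ε : ℝ => α * (1 + ε)⁻¹) 0 :=
          continuousAt_const.mul ((continuousAt_const.add continuousAt_id).inv₀ (by norm_num))
        have := hcont.tendsto.mono_left (nhdsWithin_le_nhds (s := Ioi 0))
        simpa using this
      obtain ⟨ε, h1, h2⟩ := ((h.eventually (lt_mem_nhds ha)).and self_mem_nhdsWithin).exists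
      exact ⟨ε, h2, h1⟩
    have hε1 : 0 < 1 + ε := by positivity
    -- The level k = ⌊(u - 1) / (1 + ε)⌋ satisfies k + ⌈εk⌉ ≤ u, the 1 paying for the ceiling. So
    -- the ball of radius r only meets the square of level k.
    have hlin : Tendsto (fun u : ℝ => (u - 1) * (1 + ε)⁻¹) atTop atTop :=
      (tendsto_atTop_add_const_right _ (-1) tendsto_id).atTop_mul_const (by positivity)
    have hf : Tendsto (fun u : ℝ => ⌊(u - 1) * (1 + ε)⁻¹⌋₊) atTop atTop :=
      tendsto_nat_floor_atTop.comp hlin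
    have hfc : Tendsto (fun u : ℝ => (⌊(u - 1) * (1 + ε)⁻¹⌋₊ : ℝ) / u) atTop
        (𝓝 (1 + ε)⁻¹) := by
      have h1 := (tendsto_nat_floor_div_atTop (R := ℝ)).comp hlin
      have h2 : Tendsto (fun u : ℝ => (u - 1) * (1 + ε)⁻¹ / u) atTop (𝓝 (1 + ε)⁻¹) := by
        have h3 : Tendsto (fun u : ℝ => (1 - 1 / u) * (1 + ε)⁻¹) atTop
            (𝓝 ((1 - 0) * (1 + ε)⁻¹)) :=
          (tendsto_const_nhds.sub (tendsto_const_nhds.div_atTop tendsto_id)).mul_const _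
        rw [sub_zero, one_mul] at h3
        refine h3.congr' ?_
        filter_upwards [eventually_gt_atTop 0] with u hu
        field_simp
      have h4 := h1.mul h2
      rw [one_mul] at h4
      refine h4.congr' ?_
      filter_upwards [eventually_gt_atTop 1] with u hu
      simp only [Function.comp]
      have : 0 < u - 1 := by linarith
      exact div_mul_div_cancel₀ (by positivity)
    have h := (hcomp _ _ hf hfc).eventually (lt_mem_nhds hεa)
    have hball := hf.eventually
      (hw.eventually_preimage_ball_subset hm hmn hP hrow hcol hε)
    filter_upwards [hu.eventually h, hu.eventually hball, hu.eventually (eventually_ge_atTop 1),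
      Ioo_mem_nhdsGT (zero_lt_one' ℝ)] with r hr hrb hu1 hr1
    have hlr := Real.log_neg hr1.1 hr1.2
    set u := -Real.log r / Real.log m with hudef
    have hue : u * Real.log m = -Real.log r := div_mul_cancel₀ _ hlm.ne'
    rw [hue, neg_div_neg_eq] at hr
    refine lt_of_lt_of_le hr ?_
    refine div_le_div_of_nonpos_of_le hlr.le ?_
    set k := ⌊(u - 1) * (1 + ε)⁻¹⌋₊ with hk
    rw [← Real.log_exp (logWeight p w k), ← bernoulli_real_square hm hmn hp]
    refine Real.log_le_log (measure_closedBall_code_pos hm hmn hp w hr1.1) ?_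
    rw [hμ, measureReal_map_code_closedBall hm hn]
    refine measureReal_mono (Subset.trans ?_ (hrb ⌈ε * k⌉₊ (Nat.le_ceil _)))
    refine preimage_mono (Metric.closedBall_subset_closedBall (hpow _ _ hr1.1 ?_))
    have h1 : (k : ℝ) ≤ (u - 1) * (1 + ε)⁻¹ :=
      Nat.floor_le (mul_nonneg (by linarith) (by positivity))
    rw [← div_eq_mul_inv, le_div_iff₀ hε1] at h1
    have h2 := (Nat.ceil_lt_add_one (by positivity : 0 ≤ ε * k)).le
    push_cast
    linarith
  exact tendsto_order.2 ⟨hlower, hupper⟩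

/-- At points typical for the tilt, `μ` has local dimension `meanExponent D p t`, so they lie in the
level set. The tilted measure charges them and has there the local dimension claimed as lower bound.
-/
theorem dimH_levelSet_ge (hm : 1 < m) (hmn : m < n) (hp : ∀ d ∈ D, 0 < p d)
    (hrow : ∃ d ∈ D, ∃ d' ∈ D, d.1 ≠ d'.1) (hcol : ∃ d ∈ D, ∃ d' ∈ D, d.2 ≠ d'.2)
    [IsProbabilityMeasure (digitMeasure D p)] (t : ℝ) :
    ENNReal.ofReal (meanExponent D p t * t + beta D p t) ≤
      dimH (levelSet (range (code D)) ((bernoulli D p).map (code D)) (meanExponent D p t)) := by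
  have hD : D.Nonempty := by
    obtain ⟨d, hd, -⟩ := hrow
    exact ⟨d, hd⟩
  have := isProbabilityMeasure_tilt hD hp t
  have hP := tilt_pos hp t
  have hc : Measurable (code D) := (continuous_code hm (hm.trans hmn) D).measurable
  have := Measure.isProbabilityMeasure_map (μ := bernoulli D (tilt D p t)) hc.aemeasurable
  let E : Set (EuclideanSpace ℝ (Fin 2)) := code D '' {w | IsTypical (tilt D p t) w}
  have hE : (bernoulli D (tilt D p t)).map (code D) E ≠ 0 := by
    have h1 : bernoulli D (tilt D p t) {w | IsTypical (tilt D p t) w} = 1 := by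
      rw [← measure_univ (μ := bernoulli D (tilt D p t))]
      exact measure_congr (eventuallyEq_univ.2 (ae_isTypical hP))
    -- The image `E` is not known to be measurable; only this inequality for outer measure is used.
    have h2 := (measure_mono (subset_preimage_image (code D) {w | IsTypical (tilt D p t) w})).trans
      (Measure.le_map_apply (μ := bernoulli D (tilt D p t)) hc.aemeasurable E)
    rw [h1] at h2
    exact (zero_lt_one.trans_le h2).ne'
  refine (dimH_ge_of_hasLocalDim _ hE (s := meanExponent D p t * t + beta D p t) ?_).trans
    (dimH_mono ?_)
  · rintro _ ⟨w, hw, rfl⟩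
    have h := IsTypical.hasLocalDim hm hmn hP hw hP hrow hcol
    rwa [sum_tilt_mul_digitExponent_tilt hm hD hp, add_comm, mul_comm t] at h
  · rintro _ ⟨w, hw, rfl⟩
    exact ⟨mem_range_self w, IsTypical.hasLocalDim hm hmn hp hw hP hrow hcol⟩

end Typical

end BedfordMcMullen

/-! ### The multifractal formula -/

theorem theorem1 {m n : ℕ} (hmn : m < n) (D : Finset (Fin m × Fin n)) (p : Fin m × Fin n → ℝ)
    (hp : ∀ d ∈ D, 0 < p d) (hp1 : ∑ d ∈ D, p d = 1)
    (hrow : ∃ d ∈ D, ∃ d' ∈ D, d.1 ≠ d'.1) (hcol : ∃ d ∈ D, ∃ d' ∈ D, d.2 ≠ d'.2)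
    (Λ : Set (EuclideanSpace ℝ (Fin 2))) (hΛ : BedfordMcMullen.IsCarpet D Λ)
    (μ : Measure (EuclideanSpace ℝ (Fin 2))) (hμ : BedfordMcMullen.IsSelfAffineMeasure D p μ) :
    (∀ α ∈ Ioo (BedfordMcMullen.alphaMin D p) (BedfordMcMullen.alphaMax D p),
      ((dimH (BedfordMcMullen.levelSet Λ μ α) : ENNReal) : EReal) =
        ⨅ t : ℝ, ((α * t + BedfordMcMullen.beta D p t : ℝ) : EReal)) ∧
    DifferentiableOn ℝ (fun α => (dimH (BedfordMcMullen.levelSet Λ μ α)).toReal)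
      (Ioo (BedfordMcMullen.alphaMin D p) (BedfordMcMullen.alphaMax D p)) ∧
    ConcaveOn ℝ (Ioo (BedfordMcMullen.alphaMin D p) (BedfordMcMullen.alphaMax D p))
      (fun α => (dimH (BedfordMcMullen.levelSet Λ μ α)).toReal) := by
  open BedfordMcMullen in
  have hm : 1 < m := by
    obtain ⟨d, -, d', -, h⟩ := hrow
    by_contra hm
    exact h (Fin.ext (by omega))
  have hn := hm.trans hmn
  have hD : D.Nonempty := by
    obtain ⟨d, hd, -⟩ := hrow
    exact ⟨d, hd⟩
  have := isProbabilityMeasure_digitMeasure hp hp1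
  obtain rfl := hΛ.eq_range_code hm hn
  obtain rfl := hμ.eq_map_code hm hn
  have key : ∀ α ∈ Ioo (alphaMin D p) (alphaMax D p), ∃ t, meanExponent D p t = α ∧
      0 ≤ α * t + beta D p t ∧ dimH (levelSet (range (code D)) ((bernoulli D p).map (code D)) α) =
        ENNReal.ofReal (α * t + beta D p t) := by
    intro α hα
    obtain ⟨t, rfl⟩ := exists_meanExponent_eq hm hmn hp hD hα
    refine ⟨t, rfl, ?_, le_antisymm (dimH_levelSet_le hm hmn hp hD _ t)
      (dimH_levelSet_ge hm hmn hp hrow hcol t)⟩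
    rw [mul_comm, add_comm, ← sum_tilt_mul_digitExponent_tilt hm hD hp]
    exact Finset.sum_nonneg fun d hd => mul_nonneg (tilt_pos hp t d hd).le
      (digitExponent_nonneg hm hmn (tilt_pos hp t) (sum_tilt hD hp t) hd)
  have hlt : ∀ α ∈ Ioo (alphaMin D p) (alphaMax D p), ∀ t s, t ≠ s →
      beta D p t + t * meanExponent D p t < beta D p s + s * meanExponent D p t := by
    intro α hα t s hts
    have : Nonempty D := hD.to_subtype
    obtain ⟨d₁, h₁⟩ := exists_eq_ciInf_of_finite (f := fun d : D => digitExponent D p d)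
    obtain ⟨d₂, h₂⟩ := exists_eq_ciSup_of_finite (f := fun d : D => digitExponent D p d)
    refine beta_add_lt hm hmn hp ⟨d₁, d₁.2, d₂, d₂.2, ?_⟩ hts
    exact ((h₁.trans_lt hα.1).trans (hα.2.trans_eq h₂.symm)).ne
  refine ⟨fun α hα => ?_, ?_⟩
  · obtain ⟨t, ht, h0, e⟩ := key α hα
    rw [e, EReal.coe_ennreal_ofReal, max_eq_left h0]
    refine le_antisymm (le_iInf fun s => ?_) (iInf_le _ t)
    rw [EReal.coe_le_coe_iff]
    rcases eq_or_ne t s with rfl | hts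
    · exact le_rfl
    · have := hlt α hα t s hts
      rw [ht] at this
      linarith
  -- A point of the interval is needed to apply `hlt`, since it guarantees that the digit exponents
  -- are not all equal.
  · rcases (Ioo (alphaMin D p) (alphaMax D p)).eq_empty_or_nonempty with h | ⟨α₀, hα₀⟩
    · rw [h]
      exact ⟨differentiableOn_empty, convex_empty, by simp⟩
    refine differentiableOn_and_concaveOn_of_minimizers isOpen_Ioo (convex_Ioo _ _)
      (hlt α₀ hα₀) fun α hα => ?_
    obtain ⟨t, ht, h0, e⟩ := key α hα
    exact ⟨t, ht, by rw [e, ENNReal.toReal_ofReal h0]⟩
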